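/- Let $n\ge 1$, $0<d<n$, and let $\mathcal D$ be the family of dyadic cubes $Q=2^{-k}(j+[0,1)^n)$, $k\in\mathbb Z$, $j\in\mathbb Z^n$, with side length $\ell(Q)=2^{-k}$. For $E\subset\mathbb R^n$ let $H^d(E)=\inf\{\sum_j \ell(Q_j)^d : E\subset\bigcup_j Q_j,\ Q_j\in\mathcal D\}$ be the dyadic Hausdorff content (countable coverings), for $f\ge 0$ let $\int f\,dH^d=\int_0^\infty H^d(\{f>t\})\,dt$, and put $\|f\|_{\mathcal L^p(H^d)}=(\int |f|^p\,dH^d)^{1/p}$ for $0<p<\infty$ and $\|f\|_{\mathcal L^\infty(H^d)}=\inf\{t>0: H^d(\{|f|>t\})=0\}$. For $p<\infty$ the Choquet space $\mathcal L^p(H^d)$ is the completion of the continuous functions with compact support under this functional, realised as the space of functions $f$ for which there are continuous, compactly supported $\varphi_k$ with $\|f-\varphi_k\|_{\mathcal L^p(H^d)}\to0$. Let $\Phi_0(t)=t\log(e+t)$, $\|g\|_{\Phi_0;Q}=\inf\{\lambda>0 : \frac1{|Q|}\int_Q\Phi_0(|g|/\lambda)\,dx\le 1\}$ and $M_{n-d,\Phi_0}g(x)=\sup_{Q\in\mathcal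 D}\ell(Q)^{n-d}\|g\|_{\Phi_0;Q}\mathbf 1_Q(x)$. For $1<q\le\infty$ the Orlicz–Morrey space $\mathcal M^{q}_{\Phi_0}(H^d)$ consists of the measurable $g$ with $\|g\|_{\mathcal M^q_{\Phi_0}(H^d)}=\|M_{n-d,\Phi_0}g\|_{\mathcal L^q(H^d)}<\infty$. Its associate space $\mathcal M^{q}_{\Phi_0}(H^d)'$ consists of the measurable $h$ for which $$\|h\|_{\mathcal M^{q}_{\Phi_0}(H^d)'}=\sup\Big\{\int_{\mathbb R^n}|h g|\,dx : g \text{ measurable},\ \|g\|_{\mathcal M^q_{\Phi_0}(H^d)}\le 1\Big\}$$ is finite; the same formula defines this quantity for measurable $h$ with values in $[0,\infty]$. A family $\mathcal S\subset\mathcal D$ is $\eta$-sparse ($0<\eta<1$) if there are pairwise disjoint measurable sets $E_Q\subset Q$, $Q\in\mathcal S$, with $|E_Q|\ge\eta|Q|$; put $\mathcal A_{\mathcal S}f=\sum_{Q\in\mathcal S}\big(\frac1{|Q|}\int_Q f\,dx\big)\mathbf 1_Q$. **Theorem 2.1.** Let $1\le p<\infty$, $\frac1p+\frac1{p'}=1$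 (so $p'=\infty$ if $p=1$), and $0<\eta<1$. There is a finite constant $C$, depending only on $n,d,p,\eta$, such that for every $\eta$-sparse family $\mathcal S\subset\mathcal D$: (a) for every measurable $f:\mathbb R^n\to[0,\infty]$, $\ \|\mathcal A_{\mathcal S}f\|_{\mathcal M^{p'}_{\Phi_0}(H^d)'}\le C\,\|f\|_{\mathcal L^p(H^d)}$ (the right-hand side may be infinite); (b) for every real-valued $f\in\mathcal L^p(H^d)$, $f$ is integrable on every $Q\in\mathcal S$, the series defining $\mathcal A_{\mathcal S}f$ converges absolutely almost everywhere, $\mathcal A_{\mathcal S}f\in\mathcal M^{p'}_{\Phi_0}(H^d)'$, and $\|\mathcal A_{\mathcal S}f\|_{\mathcal M^{p'}_{\Phi_0}(H^d)'}\le C\,\|f\|_{\mathcal L^p(H^d)}$. -/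

import Mathlib

open MeasureTheory Filter Topology
open scoped NNReal ENNReal

noncomputable section

/-- The dyadic cube `2^(-k) (j + [0,1)^n)`, with `k = scale` and `j = corner`.
For `n ≥ 1` the pair `(k, j)` is determined by the cube as a set. -/
structure DyadicCube (n : ℕ) where
  scale : ℤ
  corner : Fin n → ℤ

/-- The side length `ℓ(Q) = 2^(-k)`. -/
def DyadicCube.side {n : ℕ} (Q : DyadicCube n) : ℝ := (2 : ℝ) ^ (-Q.scale)

/-- The half-open cube as a set of points. -/
def DyadicCube.toSet {n : ℕ} (Q : DyadicCube n) : Set (Fin n → ℝ) :=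
  {x | ∀ i, Q.side * (Q.corner i : ℝ) ≤ x i ∧ x i < Q.side * ((Q.corner i : ℝ) + 1)}

/-- The dyadic Hausdorff content `H^d(E)`. A family of dyadic cubes is automatically countable,
and repeating a cube in a covering never decreases the sum. -/
def dyadicContent {n : ℕ} (d : ℝ) (E : Set (Fin n → ℝ)) : ℝ≥0∞ :=
  ⨅ (F : Set (DyadicCube n)) (_ : E ⊆ ⋃ Q ∈ F, Q.toSet),
    ∑' Q : F, ENNReal.ofReal (Q : DyadicCube n).side ^ d

/-- The Choquet integral `∫ f dH^d = ∫_0^∞ H^d({f > t}) dt` of a nonnegative function. -/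
def choquetIntegral {n : ℕ} (d : ℝ) (f : (Fin n → ℝ) → ℝ≥0∞) : ℝ≥0∞ :=
  ∫⁻ t in Set.Ioi (0 : ℝ), dyadicContent d {x | ENNReal.ofReal t < f x}

open Classical in
/-- The functional `‖f‖_{L^p(H^d)}` of a nonnegative function, `0 < p ≤ ∞`. -/
def choquetNorm {n : ℕ} (d : ℝ) (p : ℝ≥0∞) (f : (Fin n → ℝ) → ℝ≥0∞) : ℝ≥0∞ :=
  if p = ∞ then sInf {t : ℝ≥0∞ | 0 < t ∧ dyadicContent d {x | t < f x} = 0}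
  else choquetIntegral d (fun x => f x ^ p.toReal) ^ (1 / p.toReal)

/-- The Choquet space `L^p(H^d)`, `0 < p < ∞`: the completion of the continuous functions with
compact support, realised as a space of functions (which are identified when they differ on a set
of zero content only). -/
def choquetSpace (n : ℕ) (d : ℝ) (p : ℝ≥0∞) : Set ((Fin n → ℝ) → ℝ) :=
  {f | ∃ φ : ℕ → (Fin n → ℝ) → ℝ,
    (∀ k, Continuous (φ k) ∧ HasCompactSupport (φ k)) ∧
    Tendsto (fun k => choquetNorm d p (fun x => ‖f x - φ k x‖ₑ)) atTop (𝓝 0)}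

/-- A family of dyadic cubes is `η`-sparse. The sets `E Q` are Lebesgue measurable. -/
def IsSparseFamily {n : ℕ} (η : ℝ) (S : Set (DyadicCube n)) : Prop :=
  ∃ E : DyadicCube n → Set (Fin n → ℝ),
    (∀ Q ∈ S, NullMeasurableSet (E Q) volume ∧ E Q ⊆ Q.toSet ∧
      ENNReal.ofReal η * volume Q.toSet ≤ volume (E Q)) ∧
    S.PairwiseDisjoint E

/-- The sparse operator `A_S f = ∑_{Q ∈ S} (⨍_Q f) 1_Q` on real functions. -/
def sparseOperator {n : ℕ} (S : Set (DyadicCube n)) (f : (Fin n → ℝ) → ℝ) (x : Fin n → ℝ) : ℝ :=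
  ∑' Q : S, (Q : DyadicCube n).toSet.indicator
    (fun _ => ⨍ y in (Q : DyadicCube n).toSet, f y) x

/-- The sparse operator on nonnegative functions, with values in `[0, ∞]`. -/
def sparseOperatorENN {n : ℕ} (S : Set (DyadicCube n)) (f : (Fin n → ℝ) → ℝ≥0∞)
    (x : Fin n → ℝ) : ℝ≥0∞ :=
  ∑' Q : S, (Q : DyadicCube n).toSet.indicator
    (fun _ => ⨍⁻ y in (Q : DyadicCube n).toSet, f y ∂volume) x

/-- The function `Φ₀(t) = t log (e + t)`. -/
def Phi0 (t : ℝ≥0) : ℝ≥0∞ := ENNReal.ofReal ((t : ℝ) * Real.log (Real.exp 1 + t))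

/-- The `Φ`-average (Luxemburg norm) `‖f‖_{Φ;Q}`. -/
def orliczAverage {n : ℕ} (Φ : ℝ≥0 → ℝ≥0∞) (Q : DyadicCube n) (f : (Fin n → ℝ) → ℝ) : ℝ≥0∞ :=
  ⨅ (c : ℝ≥0) (_ : 0 < c) (_ : ⨍⁻ x in Q.toSet, Φ (‖f x‖₊ / c) ∂volume ≤ 1), (c : ℝ≥0∞)

/-- The dyadic fractional Orlicz maximal operator
`M_{α,Φ} f(x) = sup_Q ℓ(Q)^α ‖f‖_{Φ;Q} 1_Q(x)`. -/
def orliczMaximal {n : ℕ} (α : ℝ) (Φ : ℝ≥0 → ℝ≥0∞) (f : (Fin n → ℝ) → ℝ)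
    (x : Fin n → ℝ) : ℝ≥0∞ :=
  ⨆ Q : DyadicCube n,
    Q.toSet.indicator (fun _ => ENNReal.ofReal Q.side ^ α * orliczAverage Φ Q f) x

/-- The Orlicz–Morrey norm `‖f‖_{M^p_Φ(H^d)} = ‖M_{n-d,Φ} f‖_{L^p(H^d)}`. -/
def orliczMorreyNorm {n : ℕ} (d : ℝ) (p : ℝ≥0∞) (Φ : ℝ≥0 → ℝ≥0∞)
    (f : (Fin n → ℝ) → ℝ) : ℝ≥0∞ :=
  choquetNorm d p (orliczMaximal ((n : ℝ) - d) Φ f)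

/-- The associate (Köthe dual) norm `sup {∫ |f g| dx : ‖g‖_X ≤ 1}` of a nonnegative function, where
`N g = ‖g‖_X` for (Lebesgue) measurable `g`. -/
def associateNorm {n : ℕ} (N : ((Fin n → ℝ) → ℝ) → ℝ≥0∞) (f : (Fin n → ℝ) → ℝ≥0∞) : ℝ≥0∞ :=
  ⨆ (g : (Fin n → ℝ) → ℝ) (_ : AEMeasurable g volume) (_ : N g ≤ 1), ∫⁻ x, f x * ‖g x‖ₑ

/-- The associate space: the measurable functions with finite associate norm. -/
def associateSpace {n : ℕ} (N : ((Fin n → ℝ) → ℝ) → ℝ≥0∞) : Set ((Fin n → ℝ) → ℝ) :=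
  {f | AEMeasurable f volume ∧ associateNorm N (fun x => ‖f x‖ₑ) < ∞}

end

/-! The sparse operator is self-adjoint, so pairing `A_S f` with `|g|` gives `∫ f dμ` with `dμ =
A_S|g| dx`. Let `W = M_{n-d,Φ₀} g`. The heart of the matter is the growth bound `μ(R) ≤ K ℓ(R)^d
W(x)` for all `x ∈ R` (`setLIntegral_sparseOperatorENN_le`). Cubes of `S` inside `R` contribute at
most a multiple of `|R| ‖g‖_{Φ₀;R}` by `L log L` packing (`IsSparseFamily.tsum_setLIntegral_le`),
the place where `Φ₀` is needed. A strictly larger `Q ∋ x` contributes at most `|R| ℓ(Q)^{-(n-d)}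
W(x)`, a geometric series because `d < n`.

Covering by cubes turns the growth bound into `μ(E ∩ {W ≤ c}) ≤ K c H^d(E)`, and averaging over the
levels of `W` with weight `ds/s` gives `μ(E) ≤ 4K ∫ H^d(E ∩ {W > s}) ds`
(`measure_le_lintegral_dyadicContent`). Taking `E = {f > t}` and integrating in `t` leaves the
double integral of `min(H^d{f > t}, H^d{W > s})`. It equals the integral of the product of the
inverse distribution functions (`lintegral_lintegral_min`), to which Hölder's inequality on the half
line applies when `p' < ∞`; for `p' = ∞` the bound is direct. Neither subadditivity of the Choquet
integral nor a maximal inequality is used.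

For the Choquet space, approximation by test functions gives measurability and `∫ |f|^p dH^d < ∞`.
Splitting `S` at unit scale then shows `A_S|f| < ∞` almost everywhere, and `|A_S f| ≤ A_S|f|`
reduces the norm bound to the nonnegative case. -/

/-! ### Geometry of dyadic cubes -/

namespace DyadicCube

variable {n : ℕ}

theorem side_pos (Q : DyadicCube n) : 0 < Q.side := zpow_pos two_pos _

/-- The side length of a dyadic cube as an extended nonnegative number. -/
noncomputable def len (Q : DyadicCube n) : ℝ≥0∞ := ENNReal.ofReal Q.side

theorem len_ne_zero (Q : DyadicCube n) : Q.len ≠ 0 := by simp [len, Q.side_pos]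

theorem len_ne_top (Q : DyadicCube n) : Q.len ≠ ∞ := ENNReal.ofReal_ne_top

theorem len_eq_zpow (Q : DyadicCube n) : Q.len = (2 : ℝ≥0∞) ^ (-Q.scale) := by
  rw [len, side, ← Real.rpow_intCast, ← ENNReal.ofReal_rpow_of_pos two_pos,
    ENNReal.rpow_intCast, ENNReal.ofReal_ofNat]

theorem len_le_len {Q R : DyadicCube n} (h : R.scale ≤ Q.scale) : Q.len ≤ R.len :=
  ENNReal.ofReal_le_ofReal (zpow_le_zpow_right₀ one_le_two (neg_le_neg h))

theorem len_rpow_ne_zero (Q : DyadicCube n) (s : ℝ) : Q.len ^ s ≠ 0 := by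
  simp [ENNReal.rpow_eq_zero_iff, Q.len_ne_zero, Q.len_ne_top]

theorem len_rpow_ne_top (Q : DyadicCube n) (s : ℝ) : Q.len ^ s ≠ ∞ := by
  simp [ENNReal.rpow_eq_top_iff, Q.len_ne_zero, Q.len_ne_top]

instance : Countable (DyadicCube n) := by
  have : Function.Injective fun Q : DyadicCube n => (Q.scale, Q.corner) := by
    rintro ⟨k, j⟩ ⟨k', j'⟩ h
    simpa using h
  exact this.countable

theorem toSet_eq_pi (Q : DyadicCube n) :
    Q.toSet = Set.univ.pi fun i =>
      Set.Ico (Q.side * (Q.corner i : ℝ)) (Q.side * ((Q.corner i : ℝ) + 1)) := by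
  ext x
  simp [toSet]

theorem measurableSet_toSet (Q : DyadicCube n) : MeasurableSet Q.toSet := by
  rw [toSet_eq_pi]
  exact MeasurableSet.univ_pi fun i => measurableSet_Ico

theorem volume_toSet (Q : DyadicCube n) : volume Q.toSet = Q.len ^ (n : ℝ) := by
  rw [toSet_eq_pi, Real.volume_pi_Ico]
  have (i : Fin n) : Q.side * ((Q.corner i : ℝ) + 1) - Q.side * (Q.corner i : ℝ) = Q.side := by
    ring
  simp [this, len]

theorem volume_toSet_ne_zero (Q : DyadicCube n) : volume Q.toSet ≠ 0 := by
  rw [volume_toSet]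
  exact Q.len_rpow_ne_zero _

theorem volume_toSet_ne_top (Q : DyadicCube n) : volume Q.toSet ≠ ∞ := by
  rw [volume_toSet]
  exact Q.len_rpow_ne_top _

theorem mem_toSet_iff {Q : DyadicCube n} {x : Fin n → ℝ} :
    x ∈ Q.toSet ↔ ∀ i, ⌊(2 : ℝ) ^ Q.scale * x i⌋ = Q.corner i := by
  refine forall_congr' fun i => ?_
  have h2 : (0 : ℝ) < 2 ^ Q.scale := zpow_pos two_pos _
  have h : Q.side = (2 ^ Q.scale)⁻¹ := by rw [side, zpow_neg]
  rw [Int.floor_eq_iff, h, inv_mul_le_iff₀ h2, ← div_eq_inv_mul, lt_div_iff₀ h2, mul_comm (x i)]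

/-- The dyadic cube of a given scale containing a given point. -/
noncomputable def containing (k : ℤ) (x : Fin n → ℝ) : DyadicCube n :=
  ⟨k, fun i => ⌊(2 : ℝ) ^ k * x i⌋⟩

theorem mem_containing (k : ℤ) (x : Fin n → ℝ) : x ∈ (containing k x).toSet :=
  mem_toSet_iff.2 fun _ => rfl

theorem eq_of_scale_eq {Q R : DyadicCube n} (h : Q.scale = R.scale) {x : Fin n → ℝ}
    (hQ : x ∈ Q.toSet) (hR : x ∈ R.toSet) : Q = R := by
  obtain ⟨k, j⟩ := Q
  obtain ⟨k', j'⟩ := R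
  obtain rfl : k = k' := h
  congr 1
  funext i
  exact (mem_toSet_iff.1 hQ i).symm.trans (mem_toSet_iff.1 hR i)

theorem toSet_subset_of_scale_le {Q R : DyadicCube n} (h : R.scale ≤ Q.scale) {x : Fin n → ℝ}
    (hQ : x ∈ Q.toSet) (hR : x ∈ R.toSet) : Q.toSet ⊆ R.toSet := by
  intro y hy
  rw [mem_toSet_iff] at *
  obtain ⟨m, hm⟩ := Int.le.dest h
  -- Nestedness: the coarse index is the integer quotient of the fine one by `2 ^ m`, so points
  -- sharing a fine cube share the coarse one.
  have key (z : ℝ) : ⌊(2 : ℝ) ^ R.scale * z⌋ = ⌊(2 : ℝ) ^ Q.scale * z⌋ / ((2 ^ m : ℕ) : ℤ) := by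
    rw [← Int.floor_div_natCast, ← hm, zpow_add₀ two_ne_zero]
    congr 1
    push_cast
    rw [zpow_natCast]
    field_simp
  intro i
  rw [← hR i, key, key, hy i, hQ i]

/-- `Q ≼ R`: the cube `Q` is a dyadic subcube of `R`. -/
def Sub (Q R : DyadicCube n) : Prop := R.scale ≤ Q.scale ∧ Q.toSet ⊆ R.toSet

theorem sub_or_lt_or_disjoint (Q R : DyadicCube n) :
    Q.Sub R ∨ (Q.scale < R.scale ∧ R.toSet ⊆ Q.toSet) ∨ Disjoint Q.toSet R.toSet := by
  by_cases hd : Disjoint Q.toSet R.toSet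
  · exact .inr (.inr hd)
  obtain ⟨x, hQ, hR⟩ := Set.not_disjoint_iff.1 hd
  rcases le_or_gt R.scale Q.scale with h | h
  · exact .inl ⟨h, toSet_subset_of_scale_le h hQ hR⟩
  · exact .inr (.inl ⟨h, toSet_subset_of_scale_le h.le hR hQ⟩)

/-- The maximal cubes of a family of cubes contained in `R` are disjoint, so that an inequality
between two measures on the cubes of the family passes to its union. -/
theorem measure_biUnion_le_of_forall_le {μ ν : Measure (Fin n → ℝ)} {F : Set (DyadicCube n)}
    {R : DyadicCube n} (hF : ∀ Q ∈ F, Q.Sub R) (h : ∀ Q ∈ F, μ Q.toSet ≤ ν Q.toSet) :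
    μ (⋃ Q ∈ F, Q.toSet) ≤ ν R.toSet := by
  let M : Set (DyadicCube n) :=
    {Q ∈ F | ∀ Q' ∈ F, (Q.toSet ∩ Q'.toSet).Nonempty → Q.scale ≤ Q'.scale}
  have hcover : ⋃ Q ∈ F, Q.toSet ⊆ ⋃ Q ∈ M, Q.toSet := by
    intro x hx
    obtain ⟨Q, hQ, hxQ⟩ := Set.mem_iUnion₂.1 hx
    -- Maximal cubes exist because scales in `F` are bounded below by that of `R`.
    obtain ⟨k, ⟨P, hP, hxP, rfl⟩, hmin⟩ := Int.exists_least_of_bdd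
      (P := fun k => ∃ P ∈ F, x ∈ P.toSet ∧ P.scale = k)
      ⟨R.scale, by rintro _ ⟨P, hP, -, rfl⟩; exact (hF P hP).1⟩ ⟨_, Q, hQ, hxQ, rfl⟩
    refine Set.mem_iUnion₂.2 ⟨P, ⟨hP, fun P' hP' ⟨y, hy, hy'⟩ => ?_⟩, hxP⟩
    by_contra! hlt
    exact absurd (hmin _ ⟨P', hP', toSet_subset_of_scale_le hlt.le hy hy' hxP, rfl⟩) (by simpa)
  have hdisj : M.PairwiseDisjoint toSet := by
    intro Q hQ Q' hQ' hne
    refine Set.disjoint_left.2 fun x hx hx' => hne (eq_of_scale_eq (le_antisymm ?_ ?_) hx hx')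
    · exact hQ.2 Q' hQ'.1 ⟨x, hx, hx'⟩
    · exact hQ'.2 Q hQ.1 ⟨x, hx', hx⟩
  calc μ (⋃ Q ∈ F, Q.toSet) ≤ μ (⋃ Q ∈ M, Q.toSet) := measure_mono hcover
    _ ≤ ∑' Q : M, μ (Q : DyadicCube n).toSet := measure_biUnion_le μ M.to_countable _
    _ ≤ ∑' Q : M, ν (Q : DyadicCube n).toSet := ENNReal.tsum_le_tsum fun Q => h Q Q.2.1
    _ = ν (⋃ Q ∈ M, Q.toSet) :=
      (measure_biUnion M.to_countable hdisj fun Q _ => Q.measurableSet_toSet).symm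
    _ ≤ ν R.toSet := measure_mono (Set.iUnion₂_subset fun Q hQ => (hF Q hQ.1).2)

/-- The geometric series over the dyadic ancestors of a cube. -/
theorem tsum_ancestors_len_rpow_le {s : ℝ} (R : DyadicCube n) (x : Fin n → ℝ) :
    ∑' Q : {Q : DyadicCube n // Q.scale < R.scale ∧ x ∈ Q.toSet}, (Q : DyadicCube n).len ^ (-s)
      ≤ (1 - (2 : ℝ≥0∞) ^ (-s))⁻¹ * R.len ^ (-s) := by
  -- Each generation has only one cube containing `x`, so the generation gap is an injective index.
  let e : {Q : DyadicCube n // Q.scale < R.scale ∧ x ∈ Q.toSet} → ℕ :=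
    fun Q => (R.scale - (Q : DyadicCube n).scale).toNat
  have he (Q : {Q : DyadicCube n // Q.scale < R.scale ∧ x ∈ Q.toSet}) :
      (e Q : ℤ) = R.scale - (Q : DyadicCube n).scale :=
    Int.toNat_of_nonneg (sub_nonneg.2 Q.2.1.le)
  have hinj : Function.Injective e := by
    intro Q Q' h
    have h1 := he Q
    have h2 := he Q'
    rw [h] at h1
    exact Subtype.ext (eq_of_scale_eq (by lia) Q.2.2 Q'.2.2)
  have hlen (Q : {Q : DyadicCube n // Q.scale < R.scale ∧ x ∈ Q.toSet}) :
      (Q : DyadicCube n).len ^ (-s) = ((2 : ℝ≥0∞) ^ (-s)) ^ e Q * R.len ^ (-s) := by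
    have : (Q : DyadicCube n).len = 2 ^ (e Q) * R.len := by
      rw [len_eq_zpow, len_eq_zpow, ← zpow_natCast, he,
        ← ENNReal.zpow_add two_ne_zero ENNReal.ofNat_ne_top]
      congr 1
      ring
    rw [this, ENNReal.mul_rpow_of_ne_zero (by simp) R.len_ne_zero, ← ENNReal.rpow_natCast,
      ← ENNReal.rpow_natCast, ← ENNReal.rpow_mul, ← ENNReal.rpow_mul, mul_comm (e Q : ℝ)]
  calc _ = ∑' Q : {Q : DyadicCube n // Q.scale < R.scale ∧ x ∈ Q.toSet},
        ((2 : ℝ≥0∞) ^ (-s)) ^ e Q * R.len ^ (-s) := tsum_congr hlen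
    _ ≤ ∑' m : ℕ, ((2 : ℝ≥0∞) ^ (-s)) ^ m * R.len ^ (-s) :=
      ENNReal.tsum_comp_le_tsum_of_injective hinj fun m => ((2 : ℝ≥0∞) ^ (-s)) ^ m * R.len ^ (-s)
    _ = _ := by rw [ENNReal.tsum_mul_right, ENNReal.tsum_geometric]

theorem inv_one_sub_two_rpow_ne_top {s : ℝ} (hs : 0 < s) :
    (1 - (2 : ℝ≥0∞) ^ (-s))⁻¹ ≠ ∞ := by
  have : (2 : ℝ≥0∞) ^ (-s) < 1 := ENNReal.rpow_lt_one_of_one_lt_of_neg (by norm_num) (by linarith)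
  simp [tsub_eq_zero_iff_le, this]

/-- The volume restricted to a cube has `d`-dimensional growth for all `d ≤ n`. -/
theorem volume_inter_le {d : ℝ} (hd : 0 ≤ d) (hdn : d ≤ n) (Q R : DyadicCube n) :
    volume (Q.toSet ∩ R.toSet) ≤ R.len ^ ((n : ℝ) - d) * Q.len ^ d := by
  rcases le_total R.scale Q.scale with h | h
  · calc volume (Q.toSet ∩ R.toSet) ≤ volume Q.toSet := measure_mono Set.inter_subset_left
      _ = Q.len ^ ((n : ℝ) - d) * Q.len ^ d := by
        rw [volume_toSet, ← ENNReal.rpow_add _ _ Q.len_ne_zero Q.len_ne_top, sub_add_cancel]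
      _ ≤ _ := by gcongr; exact len_le_len h
  · calc volume (Q.toSet ∩ R.toSet) ≤ volume R.toSet := measure_mono Set.inter_subset_right
      _ = R.len ^ ((n : ℝ) - d) * R.len ^ d := by
        rw [volume_toSet, ← ENNReal.rpow_add _ _ R.len_ne_zero R.len_ne_top, sub_add_cancel]
      _ ≤ _ := by gcongr; exact len_le_len h

end DyadicCube

/-! ### Dyadic Hausdorff content -/

section Content

variable {n : ℕ} {d : ℝ}

theorem dyadicContent_le_tsum {E : Set (Fin n → ℝ)} {F : Set (DyadicCube n)}
    (hF : E ⊆ ⋃ Q ∈ F, Q.toSet) : dyadicContent d E ≤ ∑' Q : F, (Q : DyadicCube n).len ^ d :=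
  iInf₂_le F hF

theorem dyadicContent_mono {E E' : Set (Fin n → ℝ)} (h : E ⊆ E') :
    dyadicContent d E ≤ dyadicContent d E' :=
  le_iInf₂ fun _ hF => dyadicContent_le_tsum (h.trans hF)

theorem exists_cover_of_dyadicContent_lt {E : Set (Fin n → ℝ)} {c : ℝ≥0∞}
    (h : dyadicContent d E < c) :
    ∃ F : Set (DyadicCube n), E ⊆ ⋃ Q ∈ F, Q.toSet ∧ ∑' Q : F, (Q : DyadicCube n).len ^ d < c := by
  simpa [dyadicContent, iInf_lt_iff, DyadicCube.len] using h

theorem dyadicContent_empty : dyadicContent d (∅ : Set (Fin n → ℝ)) = 0 :=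
  le_antisymm ((dyadicContent_le_tsum (F := ∅) (by simp)).trans (by simp)) zero_le

theorem dyadicContent_union_le (E E' : Set (Fin n → ℝ)) :
    dyadicContent d (E ∪ E') ≤ dyadicContent d E + dyadicContent d E' := by
  refine ENNReal.le_of_forall_pos_le_add fun ε hε hfin => ?_
  have hε' : (ε : ℝ≥0∞) / 2 ≠ 0 := by simpa using hε.ne'
  obtain ⟨F, hF, hFs⟩ := exists_cover_of_dyadicContent_lt
    (ENNReal.lt_add_right (ENNReal.add_lt_top.1 hfin).1.ne hε')
  obtain ⟨F', hF', hFs'⟩ := exists_cover_of_dyadicContent_lt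
    (ENNReal.lt_add_right (ENNReal.add_lt_top.1 hfin).2.ne hε')
  calc dyadicContent d (E ∪ E') ≤ ∑' Q : ↑(F ∪ F'), (Q : DyadicCube n).len ^ d :=
        dyadicContent_le_tsum (by
          rw [Set.biUnion_union]
          exact Set.union_subset_union hF hF')
    _ ≤ ∑' Q : F, (Q : DyadicCube n).len ^ d + ∑' Q : F', (Q : DyadicCube n).len ^ d :=
        ENNReal.tsum_union_le (fun Q : DyadicCube n => Q.len ^ d) F F'
    _ ≤ (dyadicContent d E + ε / 2) + (dyadicContent d E' + ε / 2) := add_le_add hFs.le hFs'.le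
    _ = _ := by rw [add_add_add_comm, ENNReal.add_halves]

/-- In a covering with sum below `1` every side is at most `1`, hence `ℓ^n ≤ ℓ^d` cube by cube. -/
theorem volume_le_dyadicContent_of_lt_one (hd : 0 < d) (hdn : d ≤ n) {E : Set (Fin n → ℝ)}
    (h : dyadicContent d E < 1) : volume E ≤ dyadicContent d E := by
  refine le_of_forall_gt fun c hc => ?_
  obtain ⟨F, hF, hFs⟩ := exists_cover_of_dyadicContent_lt (lt_min hc h)
  calc volume E ≤ volume (⋃ Q ∈ F, Q.toSet) := measure_mono hF
    _ ≤ ∑' Q : F, volume (Q : DyadicCube n).toSet := measure_biUnion_le _ F.to_countable _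
    _ ≤ ∑' Q : F, (Q : DyadicCube n).len ^ d := by
      refine ENNReal.tsum_le_tsum fun Q => ?_
      have h1 : (Q : DyadicCube n).len ^ d < 1 :=
        (ENNReal.le_tsum Q).trans_lt (hFs.trans_le (min_le_right _ _))
      have h2 : (Q : DyadicCube n).len ≤ 1 := by
        by_contra! hlt
        exact absurd (ENNReal.one_lt_rpow hlt hd) (by simpa using h1.le)
      rw [DyadicCube.volume_toSet]
      exact ENNReal.rpow_le_rpow_of_exponent_ge h2 hdn
    _ < c := hFs.trans_le (min_le_left _ _)

theorem volume_eq_zero_of_dyadicContent_eq_zero (hd : 0 < d) (hdn : d ≤ n) {E : Set (Fin n → ℝ)}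
    (h : dyadicContent d E = 0) : volume E = 0 :=
  le_antisymm (h ▸ volume_le_dyadicContent_of_lt_one hd hdn (by simp [h])) zero_le

theorem dyadicContent_lt_top_of_isBounded {E : Set (Fin n → ℝ)} (hE : Bornology.IsBounded E) :
    dyadicContent d E < ∞ := by
  obtain ⟨r, hr⟩ := hE.subset_closedBall 0
  obtain ⟨N, hN⟩ := exists_nat_ge r
  let F : Set (DyadicCube n) := (fun j => ⟨0, j⟩) '' Set.Icc (fun _ => -(N : ℤ)) (fun _ => (N : ℤ))
  have hfin : F.Finite := (Set.finite_Icc _ _).image _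
  refine (dyadicContent_le_tsum (F := F) fun x hx => ?_).trans_lt ?_
  · refine Set.mem_iUnion₂.2 ⟨DyadicCube.containing 0 x, ⟨_, ⟨?_, ?_⟩, rfl⟩,
      DyadicCube.mem_containing 0 x⟩
    all_goals
      intro i
      have h1 : |x i| ≤ N := by
        have := mem_closedBall_zero_iff.1 (hr hx)
        exact (norm_le_pi_norm x i).trans (this.trans hN)
      obtain ⟨h2, h3⟩ := abs_le.1 h1
    · exact Int.le_floor.2 (by simpa using h2)
    · refine (Int.cast_le (R := ℝ)).1 ((Int.floor_le ((2 : ℝ) ^ (0 : ℤ) * x i)).trans ?_)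
      simpa using h3
  · have := hfin.fintype
    rw [tsum_fintype]
    exact ENNReal.sum_lt_top.2 fun Q _ => (DyadicCube.len_rpow_ne_top _ _).lt_top

end Content

/-! ### Layer-cake formula in the form of the Choquet integral -/

section LayerCake

variable {α : Type*} [MeasurableSpace α]

theorem volume_Ioi_inter_ofReal_lt (a : ℝ≥0∞) :
    volume (Set.Ioi (0 : ℝ) ∩ {t | ENNReal.ofReal t < a}) = a := by
  rcases eq_or_ne a ∞ with rfl | ha
  · simp
  · have : Set.Ioi (0 : ℝ) ∩ {t | ENNReal.ofReal t < a} = Set.Ioo 0 a.toReal := by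
      ext t
      refine and_congr_right fun ht => ?_
      exact ENNReal.ofReal_lt_iff_lt_toReal (le_of_lt ht) ha
    simp [this, ha]

theorem lintegral_indicator_ofReal_lt (a : ℝ≥0∞) :
    ∫⁻ t in Set.Ioi (0 : ℝ), {t | ENNReal.ofReal t < a}.indicator 1 t = a := by
  rw [lintegral_indicator_one (measurableSet_lt ENNReal.measurable_ofReal measurable_const),
    Measure.restrict_apply (measurableSet_lt ENNReal.measurable_ofReal measurable_const),
    Set.inter_comm, volume_Ioi_inter_ofReal_lt]

theorem lintegral_eq_lintegral_measure_ofReal_lt {μ : Measure α} [SFinite μ] {f : α → ℝ≥0∞}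
    (hf : AEMeasurable f μ) :
    ∫⁻ x, f x ∂μ = ∫⁻ t in Set.Ioi (0 : ℝ), μ {x | ENNReal.ofReal t < f x} := by
  wlog hm : Measurable f generalizing f
  · rw [lintegral_congr_ae hf.ae_eq_mk, this hf.measurable_mk.aemeasurable hf.measurable_mk]
    refine lintegral_congr fun t => measure_congr ?_
    filter_upwards [hf.ae_eq_mk] with x hx
    exact congrArg (ENNReal.ofReal t < ·) hx.symm
  have hms : MeasurableSet {z : α × ℝ | ENNReal.ofReal z.2 < f z.1} :=
    measurableSet_lt (ENNReal.measurable_ofReal.comp measurable_snd) (hm.comp measurable_fst)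
  calc ∫⁻ x, f x ∂μ
      = ∫⁻ x, (∫⁻ t in Set.Ioi (0 : ℝ),
          {z : α × ℝ | ENNReal.ofReal z.2 < f z.1}.indicator (fun _ => 1) (x, t)) ∂μ :=
        lintegral_congr fun x => (lintegral_indicator_ofReal_lt (f x)).symm
    _ = ∫⁻ t in Set.Ioi (0 : ℝ), ∫⁻ x,
          {z : α × ℝ | ENNReal.ofReal z.2 < f z.1}.indicator (fun _ => 1) (x, t) ∂μ :=
        lintegral_lintegral_swap (measurable_const.indicator hms).aemeasurable
    _ = _ := by
      refine lintegral_congr fun t => ?_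
      exact lintegral_indicator_one (hms.preimage (measurable_id.prodMk measurable_const))

end LayerCake

/-! ### Measures with weighted `d`-dimensional growth -/

section Adams

variable {n : ℕ} {d : ℝ} {μ : Measure (Fin n → ℝ)} {W : (Fin n → ℝ) → ℝ≥0∞} {K : ℝ≥0∞}

/-- A covering cube that meets `{W ≤ c}` may be tested at a point of that set, where the growth
bound reads `K c ℓ^d`; the other cubes contribute nothing. -/
theorem measure_inter_le_mul_tsum
    (hμ : ∀ Q : DyadicCube n, ∀ x ∈ Q.toSet, μ Q.toSet ≤ K * Q.len ^ d * W x)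
    {E : Set (Fin n → ℝ)} {F : Set (DyadicCube n)} (hF : E ⊆ ⋃ Q ∈ F, Q.toSet) (c : ℝ≥0∞) :
    μ (E ∩ {x | W x ≤ c}) ≤ K * c * ∑' Q : F, (Q : DyadicCube n).len ^ d := by
  calc μ (E ∩ {x | W x ≤ c}) ≤ μ (⋃ Q ∈ F, Q.toSet ∩ {x | W x ≤ c}) := by
        rw [← Set.iUnion₂_inter]
        exact measure_mono (Set.inter_subset_inter_left _ hF)
    _ ≤ ∑' Q : F, μ ((Q : DyadicCube n).toSet ∩ {x | W x ≤ c}) :=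
        measure_biUnion_le _ F.to_countable _
    _ ≤ ∑' Q : F, K * c * (Q : DyadicCube n).len ^ d := by
        refine ENNReal.tsum_le_tsum fun Q => ?_
        rcases ((Q : DyadicCube n).toSet ∩ {x | W x ≤ c}).eq_empty_or_nonempty with h | ⟨x, hx, hc⟩
        · simp [h]
        · calc _ ≤ μ (Q : DyadicCube n).toSet := measure_mono Set.inter_subset_left
            _ ≤ K * (Q : DyadicCube n).len ^ d * W x := hμ Q x hx
            _ ≤ K * (Q : DyadicCube n).len ^ d * c := by gcongr; exact hc
            _ = _ := by ring
    _ = _ := ENNReal.tsum_mul_left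

theorem measure_inter_le_mul_dyadicContent (hK : K ≠ ∞)
    (hμ : ∀ Q : DyadicCube n, ∀ x ∈ Q.toSet, μ Q.toSet ≤ K * Q.len ^ d * W x)
    (E : Set (Fin n → ℝ)) {c : ℝ≥0∞} (hc : c ≠ ∞) :
    μ (E ∩ {x | W x ≤ c}) ≤ K * c * dyadicContent d E := by
  -- Passing to the infimum over coverings divides by `K * c`; when this vanishes, one covering
  -- suffices.
  rcases eq_or_ne (K * c) 0 with h0 | h0
  · refine (measure_inter_le_mul_tsum hμ (F := Set.univ) (fun x _ => ?_) c).trans (by simp [h0])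
    exact Set.mem_iUnion₂.2 ⟨_, trivial, DyadicCube.mem_containing 0 x⟩
  · have ht : K * c ≠ ∞ := ENNReal.mul_ne_top hK hc
    rw [mul_comm, ← ENNReal.div_le_iff h0 ht]
    refine le_iInf₂ fun F hF => ?_
    rw [ENNReal.div_le_iff h0 ht, mul_comm]
    exact measure_inter_le_mul_tsum hμ hF c

/-- The exact value is `log 2`; bounding `1/s` below by `1/w` on `[w/2, w)` already gives one half.
-/
theorem half_le_lintegral_inv {w : ℝ≥0∞} (h0 : w ≠ 0) (ht : w ≠ ∞) :
    1 / 2 ≤ ∫⁻ s in Set.Ioi (0 : ℝ), {s | ENNReal.ofReal s < w ∧ w ≤ 2 * ENNReal.ofReal s}.indicator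
      (fun s => (ENNReal.ofReal s)⁻¹) s := by
  obtain ⟨r, rfl⟩ : ∃ r : ℝ, w = ENNReal.ofReal r := ⟨_, (ENNReal.ofReal_toReal ht).symm⟩
  have hr : 0 < r := by simpa using h0
  calc (1 : ℝ≥0∞) / 2 = ∫⁻ s in Set.Ico (r / 2) r, (ENNReal.ofReal r)⁻¹ := by
        rw [setLIntegral_const, Real.volume_Ico, ← ENNReal.ofReal_inv_of_pos hr,
          ← ENNReal.ofReal_mul (by positivity)]
        rw [show r⁻¹ * (r - r / 2) = 2⁻¹ by field_simp; norm_num,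
          ENNReal.ofReal_inv_of_pos two_pos]
        simp
    _ ≤ ∫⁻ s in Set.Ioi (0 : ℝ), (Set.Ico (r / 2) r).indicator
          (fun _ => (ENNReal.ofReal r)⁻¹) s := by
        rw [setLIntegral_indicator measurableSet_Ico, Set.inter_eq_left.2]
        exact fun s hs => (half_pos hr).trans_le hs.1
    _ ≤ _ := by
        refine lintegral_mono (Set.indicator_le fun t ht => ?_)
        have ht0 : 0 ≤ t := (half_pos hr).le.trans ht.1
        rw [Set.indicator_of_mem]
        · exact ENNReal.inv_le_inv.2 (ENNReal.ofReal_le_ofReal ht.2.le)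
        · refine ⟨(ENNReal.ofReal_lt_ofReal_iff hr).2 ht.2, ?_⟩
          rw [← ENNReal.ofReal_ofNat 2, ← ENNReal.ofReal_mul zero_le_two]
          exact ENNReal.ofReal_le_ofReal (by linarith [ht.1])

/-- A measure with `μ(Q) ≤ K ℓ(Q)^d W` on `Q` is controlled by the Choquet integral of `W`. -/
theorem measure_le_lintegral_dyadicContent [SFinite μ] (hd : 0 < d) (hdn : d ≤ n)
    (hac : μ ≪ volume) (hW : Measurable W) (hK0 : K ≠ 0) (hK : K ≠ ∞)
    (hμ : ∀ Q : DyadicCube n, ∀ x ∈ Q.toSet, μ Q.toSet ≤ K * Q.len ^ d * W x)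
    (E : Set (Fin n → ℝ)) :
    μ E ≤ 4 * K * ∫⁻ s in Set.Ioi (0 : ℝ), dyadicContent d (E ∩ {x | ENNReal.ofReal s < W x}) := by
  rcases eq_or_ne (∫⁻ s in Set.Ioi (0 : ℝ), dyadicContent d (E ∩ {x | ENNReal.ofReal s < W x})) ∞
    with h | h
  · simp [h, hK0, ENNReal.mul_top]
  -- Positive content of `{W = ∞}` in `E` would make the right-hand side infinite, since this set
  -- lies in every `{W > s}`.
  have htop : μ (E ∩ {x | W x = ∞}) = 0 := by
    refine hac (volume_eq_zero_of_dyadicContent_eq_zero hd hdn ?_)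
    by_contra hne
    refine h (top_unique ?_)
    calc ∞ = ∫⁻ s in Set.Ioi (0 : ℝ), dyadicContent d (E ∩ {x | W x = ∞}) := by
          simp [hne, ENNReal.mul_top]
      _ ≤ _ := lintegral_mono fun s => dyadicContent_mono <| Set.inter_subset_inter_right _ <| by
          intro x (hx : W x = ∞)
          simp [hx]
  have hzero : μ (E ∩ {x | W x = 0}) = 0 := by
    refine le_antisymm ?_ zero_le
    simpa using measure_inter_le_mul_dyadicContent hK hμ E (c := 0) (by simp)
  have hae : ∀ᵐ x ∂μ.restrict E, W x ≠ 0 ∧ W x ≠ ∞ := by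
    rw [ae_iff, Measure.restrict_apply]
    · refine measure_mono_null ?_ (measure_union_null htop hzero)
      rintro x ⟨hx, hxE⟩
      by_cases h0 : W x = 0
      · exact .inr ⟨hxE, h0⟩
      · exact .inl ⟨hxE, by simpa [h0] using hx⟩
    · exact (((hW (measurableSet_singleton 0)).compl).inter
        ((hW (measurableSet_singleton ∞)).compl)).compl
  let A : Set ((Fin n → ℝ) × ℝ) :=
    {z | ENNReal.ofReal z.2 < W z.1 ∧ W z.1 ≤ 2 * ENNReal.ofReal z.2}
  have hA : MeasurableSet A :=
    (measurableSet_lt (ENNReal.measurable_ofReal.comp measurable_snd)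
      (hW.comp measurable_fst)).inter (measurableSet_le (hW.comp measurable_fst)
        ((ENNReal.measurable_ofReal.comp measurable_snd).const_mul 2))
  -- On the slice `s < W ≤ 2s` the truncated bound costs `2sK`, and the weight `1/s` cancels the
  -- `s`. The final `4` is this `2` times the inverse of the one half.
  have hkey : μ E * (1 / 2) ≤ 2 * K * ∫⁻ s in Set.Ioi (0 : ℝ),
      dyadicContent d (E ∩ {x | ENNReal.ofReal s < W x}) := by
    calc μ E * (1 / 2) = ∫⁻ x in E, 1 / 2 ∂μ := by rw [setLIntegral_const, mul_comm]
      _ ≤ ∫⁻ x in E, (∫⁻ s in Set.Ioi (0 : ℝ),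
            A.indicator (fun z => (ENNReal.ofReal z.2)⁻¹) (x, s)) ∂μ := by
          refine lintegral_mono_ae ?_
          filter_upwards [hae] with x hx
          exact half_le_lintegral_inv hx.1 hx.2
      _ = ∫⁻ s in Set.Ioi (0 : ℝ), ∫⁻ x in E,
            A.indicator (fun z => (ENNReal.ofReal z.2)⁻¹) (x, s) ∂μ :=
          lintegral_lintegral_swap
            (((ENNReal.measurable_ofReal.comp measurable_snd).inv.indicator hA).aemeasurable)
      _ ≤ ∫⁻ s in Set.Ioi (0 : ℝ),
            2 * K * dyadicContent d (E ∩ {x | ENNReal.ofReal s < W x}) := by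
          refine setLIntegral_mono' measurableSet_Ioi fun s hs => ?_
          have hs0 : ENNReal.ofReal s ≠ 0 := by simpa using hs
          calc _ = ∫⁻ x in E, {x | ENNReal.ofReal s < W x ∧ W x ≤ 2 * ENNReal.ofReal s}.indicator
                (fun _ => (ENNReal.ofReal s)⁻¹) x ∂μ := rfl
            _ = (ENNReal.ofReal s)⁻¹ *
                μ ((E ∩ {x | ENNReal.ofReal s < W x}) ∩ {x | W x ≤ 2 * ENNReal.ofReal s}) := by
              have hm : MeasurableSet
                  {x | ENNReal.ofReal s < W x ∧ W x ≤ 2 * ENNReal.ofReal s} :=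
                (measurableSet_lt measurable_const hW).inter (measurableSet_le hW measurable_const)
              rw [lintegral_indicator_const hm, Measure.restrict_apply hm, Set.inter_assoc,
                Set.inter_comm]
              rfl
            _ ≤ (ENNReal.ofReal s)⁻¹ * (K * (2 * ENNReal.ofReal s) *
                dyadicContent d (E ∩ {x | ENNReal.ofReal s < W x})) := by
              gcongr
              exact measure_inter_le_mul_dyadicContent hK hμ _
                (ENNReal.mul_ne_top (by simp) ENNReal.ofReal_ne_top)
            _ = ((ENNReal.ofReal s)⁻¹ * ENNReal.ofReal s) * (2 * K *
                dyadicContent d (E ∩ {x | ENNReal.ofReal s < W x})) := by ring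
            _ = _ := by rw [ENNReal.inv_mul_cancel hs0 ENNReal.ofReal_ne_top, one_mul]
      _ = _ := lintegral_const_mul' _ _ (ENNReal.mul_ne_top (by simp) hK)
  calc μ E = 2 * (μ E * (1 / 2)) := by
        rw [mul_left_comm, one_div, ENNReal.mul_inv_cancel two_ne_zero (by simp), mul_one]
    _ ≤ 2 * (2 * K * ∫⁻ s in Set.Ioi (0 : ℝ),
          dyadicContent d (E ∩ {x | ENNReal.ofReal s < W x})) := by gcongr
    _ = _ := by ring

/-- The content of `{f > t} ∩ {W > s}` is bounded only by the smaller of the two contents; this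
leaves an expression in the two distribution functions alone. -/
theorem lintegral_le_lintegral_lintegral_min [SFinite μ] (hd : 0 < d) (hdn : d ≤ n)
    (hac : μ ≪ volume) (hW : Measurable W) (hK0 : K ≠ 0) (hK : K ≠ ∞)
    (hμ : ∀ Q : DyadicCube n, ∀ x ∈ Q.toSet, μ Q.toSet ≤ K * Q.len ^ d * W x)
    {f : (Fin n → ℝ) → ℝ≥0∞} (hf : AEMeasurable f μ) :
    ∫⁻ x, f x ∂μ ≤ 4 * K * ∫⁻ t in Set.Ioi (0 : ℝ), ∫⁻ s in Set.Ioi (0 : ℝ),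
      min (dyadicContent d {x | ENNReal.ofReal t < f x})
        (dyadicContent d {x | ENNReal.ofReal s < W x}) := by
  rw [lintegral_eq_lintegral_measure_ofReal_lt hf,
    ← lintegral_const_mul' _ _ (ENNReal.mul_ne_top (by simp) hK)]
  refine lintegral_mono fun t => ?_
  refine (measure_le_lintegral_dyadicContent hd hdn hac hW hK0 hK hμ _).trans ?_
  gcongr with s
  exact le_min (dyadicContent_mono Set.inter_subset_left)
    (dyadicContent_mono Set.inter_subset_right)

/-- A measure of dimension `d` is dominated by the Choquet integral. -/
theorem lintegral_le_mul_choquetIntegral [SFinite μ] (hK : K ≠ ∞)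
    (hμ : ∀ Q : DyadicCube n, μ Q.toSet ≤ K * Q.len ^ d)
    {f : (Fin n → ℝ) → ℝ≥0∞} (hf : AEMeasurable f μ) :
    ∫⁻ x, f x ∂μ ≤ K * choquetIntegral d f := by
  rw [lintegral_eq_lintegral_measure_ofReal_lt hf, choquetIntegral, ← lintegral_const_mul' _ _ hK]
  refine lintegral_mono fun t => ?_
  simpa using measure_inter_le_mul_dyadicContent (W := 1) (c := 1) hK
    (by simpa using fun Q _ _ => hμ Q)
    {x | ENNReal.ofReal t < f x} (by simp)

end Adams

/-! ### Inverse distribution functions on the half line -/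

section Rearrangement

/-- The generalised inverse of an antitone function on the half line. -/
noncomputable def rearrangement (F : ℝ → ℝ≥0∞) (u : ℝ) : ℝ≥0∞ :=
  volume (Set.Ioi (0 : ℝ) ∩ {t | ENNReal.ofReal u < F t})

variable {F G : ℝ → ℝ≥0∞}

theorem measurableSet_ofReal_lt (hF : Measurable F) :
    MeasurableSet {z : ℝ × ℝ | ENNReal.ofReal z.2 < F z.1} :=
  measurableSet_lt (ENNReal.measurable_ofReal.comp measurable_snd) (hF.comp measurable_fst)

theorem rearrangement_eq_lintegral (hF : Measurable F) (u : ℝ) :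
    rearrangement F u = ∫⁻ t in Set.Ioi (0 : ℝ),
      {z : ℝ × ℝ | ENNReal.ofReal z.2 < F z.1}.indicator (fun _ => 1) (t, u) := by
  have hm : MeasurableSet {t | ENNReal.ofReal u < F t} := measurableSet_lt measurable_const hF
  rw [rearrangement, Set.inter_comm, ← Measure.restrict_apply hm]
  exact (lintegral_indicator_one hm).symm

theorem measurable_rearrangement (hF : Measurable F) : Measurable (rearrangement F) := by
  rw [funext (rearrangement_eq_lintegral hF)]
  exact ((measurable_const (a := (1 : ℝ≥0∞))).indicator
    (measurableSet_ofReal_lt hF)).lintegral_prod_left'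

theorem lintegral_rearrangement (hF : Measurable F) :
    ∫⁻ u in Set.Ioi (0 : ℝ), rearrangement F u = ∫⁻ t in Set.Ioi (0 : ℝ), F t := by
  simp_rw [rearrangement_eq_lintegral hF]
  rw [lintegral_lintegral_swap]
  · exact lintegral_congr fun t => lintegral_indicator_ofReal_lt (F t)
  · exact (((measurable_const (a := (1 : ℝ≥0∞))).indicator
      (measurableSet_ofReal_lt hF)).comp measurable_swap).aemeasurable

/-- Write `min a b = ∫ 1_{u < a} 1_{u < b} du` and apply Tonelli: for fixed `u` the variables `t`
and `s` separate. -/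
theorem lintegral_lintegral_min (hF : Measurable F) (hG : Measurable G) :
    ∫⁻ t in Set.Ioi (0 : ℝ), ∫⁻ s in Set.Ioi (0 : ℝ), min (F t) (G s) =
      ∫⁻ u in Set.Ioi (0 : ℝ), rearrangement F u * rearrangement G u := by
  let A (F : ℝ → ℝ≥0∞) (z : ℝ × ℝ) : ℝ≥0∞ :=
    {z : ℝ × ℝ | ENNReal.ofReal z.2 < F z.1}.indicator (fun _ => 1) z
  have hA {F : ℝ → ℝ≥0∞} (hF : Measurable F) : Measurable (A F) :=
    measurable_const.indicator (measurableSet_ofReal_lt hF)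
  have hmin (t s : ℝ) : min (F t) (G s) = ∫⁻ u in Set.Ioi (0 : ℝ), A F (t, u) * A G (s, u) := by
    rw [← lintegral_indicator_ofReal_lt (min (F t) (G s))]
    refine lintegral_congr fun u => ?_
    by_cases h1 : ENNReal.ofReal u < F t <;> by_cases h2 : ENNReal.ofReal u < G s <;>
      simp [A, h1, h2]
  calc _ = ∫⁻ t in Set.Ioi (0 : ℝ), ∫⁻ u in Set.Ioi (0 : ℝ), A F (t, u) * rearrangement G u := by
        refine lintegral_congr fun t => ?_
        simp_rw [hmin]
        rw [lintegral_lintegral_swap]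
        · refine lintegral_congr fun u => ?_
          rw [rearrangement_eq_lintegral hG]
          exact lintegral_const_mul _ ((hA hG).comp (measurable_id.prodMk measurable_const))
        · exact (((hA hF).comp (measurable_const.prodMk measurable_snd)).mul (hA hG)).aemeasurable
    _ = ∫⁻ u in Set.Ioi (0 : ℝ), ∫⁻ t in Set.Ioi (0 : ℝ), A F (t, u) * rearrangement G u :=
        lintegral_lintegral_swap
          ((hA hF).mul ((measurable_rearrangement hG).comp measurable_snd)).aemeasurable
    _ = _ := by
        refine lintegral_congr fun u => ?_
        rw [rearrangement_eq_lintegral hF]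
        exact lintegral_mul_const _ ((hA hF).comp (measurable_id.prodMk measurable_const))

/-- Monotonicity replaces a change of variables: for any `c` below the inverse of `F` at `u`, `F c >
u`, so `G > u` on all of `(0, c^p]`. -/
theorem rearrangement_rpow_le (hF : Antitone F) {G : ℝ → ℝ≥0∞} {p : ℝ} (hp : 0 < p)
    (hFG : ∀ t, 0 < t → F t ≤ G (t ^ p)) (hG : Antitone G) (u : ℝ) :
    rearrangement F u ^ p ≤ rearrangement G u := by
  by_contra! hlt
  rw [← ENNReal.rpow_inv_lt_iff hp] at hlt
  obtain ⟨c, hc1, hc2⟩ := ENNReal.lt_iff_exists_nnreal_btwn.1 hlt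
  rw [ENNReal.rpow_inv_lt_iff hp] at hc1
  have hc0 : 0 < (c : ℝ) := by
    rcases eq_or_ne c 0 with rfl | h
    · simp [hp] at hc1
    · exact NNReal.coe_pos.2 (pos_iff_ne_zero.2 h)
  have hmem : ENNReal.ofReal u < F c := by
    by_contra hn
    refine absurd hc2 (not_lt.2 ?_)
    calc rearrangement F u ≤ volume (Set.Ioo (0 : ℝ) c) := by
          refine measure_mono fun t ⟨ht0, ht⟩ => ⟨ht0, ?_⟩
          by_contra! hct
          exact hn (lt_of_lt_of_le ht (hF hct))
      _ = c := by simp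
  refine absurd hc1 (not_lt.2 ?_)
  calc (c : ℝ≥0∞) ^ p = volume (Set.Ioc (0 : ℝ) (c ^ p)) := by
        simp [ENNReal.ofReal_rpow_of_pos hc0 |>.symm]
    _ ≤ rearrangement G u := by
        refine measure_mono fun t ht => ⟨ht.1, ?_⟩
        exact hmem.trans_le ((hFG c hc0).trans (hG ht.2))

end Rearrangement

/-! ### Choquet norms and Hölder's inequality -/

section Choquet

variable {n : ℕ} {d : ℝ}

theorem antitone_dyadicContent_ofReal_lt (f : (Fin n → ℝ) → ℝ≥0∞) :
    Antitone fun t : ℝ => dyadicContent d {x | ENNReal.ofReal t < f x} :=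
  fun _ _ hst => dyadicContent_mono fun _ hx => (ENNReal.ofReal_le_ofReal hst).trans_lt hx

theorem lintegral_rearrangement_rpow_le (f : (Fin n → ℝ) → ℝ≥0∞) {p : ℝ} (hp : 0 < p) :
    ∫⁻ u in Set.Ioi (0 : ℝ),
      rearrangement (fun t => dyadicContent d {x | ENNReal.ofReal t < f x}) u ^ p
        ≤ choquetIntegral d (fun x => f x ^ p) := by
  rw [choquetIntegral, ← lintegral_rearrangement (antitone_dyadicContent_ofReal_lt _).measurable]
  refine lintegral_mono fun u => rearrangement_rpow_le (antitone_dyadicContent_ofReal_lt _) hp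
    (fun t ht => dyadicContent_mono fun x hx => ?_) (antitone_dyadicContent_ofReal_lt _) u
  show ENNReal.ofReal (t ^ p) < f x ^ p
  rw [← ENNReal.ofReal_rpow_of_pos ht]
  exact ENNReal.rpow_lt_rpow hx hp

theorem choquetNorm_of_ne_top {p : ℝ≥0∞} (hp : p ≠ ∞) (f : (Fin n → ℝ) → ℝ≥0∞) :
    choquetNorm d p f = choquetIntegral d (fun x => f x ^ p.toReal) ^ (1 / p.toReal) :=
  if_neg hp

theorem dyadicContent_eq_zero_of_choquetNorm_top_lt {f : (Fin n → ℝ) → ℝ≥0∞} {c : ℝ≥0∞}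
    (h : choquetNorm d ∞ f < c) : dyadicContent d {x | c < f x} = 0 := by
  rw [choquetNorm, if_pos rfl] at h
  obtain ⟨t, ⟨-, ht⟩, htc⟩ := sInf_lt_iff.1 h
  exact le_antisymm ((dyadicContent_mono fun x hx => htc.trans hx).trans ht.le) zero_le

/-- Hölder's inequality for the product of the distribution functions. -/
theorem lintegral_lintegral_min_le_choquetNorm_mul {p p' : ℝ≥0∞} (hp_top : p ≠ ∞)
    (hpp' : ENNReal.HolderConjugate p p') (f g : (Fin n → ℝ) → ℝ≥0∞) :
    ∫⁻ t in Set.Ioi (0 : ℝ), ∫⁻ s in Set.Ioi (0 : ℝ),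
      min (dyadicContent d {x | ENNReal.ofReal t < f x})
        (dyadicContent d {x | ENNReal.ofReal s < g x}) ≤ choquetNorm d p f * choquetNorm d p' g := by
  have hF := (antitone_dyadicContent_ofReal_lt (d := d) f).measurable
  have hG := (antitone_dyadicContent_ofReal_lt (d := d) g).measurable
  rcases eq_or_ne p' ∞ with rfl | hp'
  · obtain rfl : p = 1 := by simpa using ENNReal.holderConjugate_iff.1 hpp'
    calc _ ≤ ∫⁻ t in Set.Ioi (0 : ℝ), dyadicContent d {x | ENNReal.ofReal t < f x} *
          choquetNorm d ∞ g := by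
          refine lintegral_mono fun t => ?_
          calc _ ≤ ∫⁻ s in Set.Ioi (0 : ℝ), dyadicContent d {x | ENNReal.ofReal t < f x} *
                {s | ENNReal.ofReal s < choquetNorm d ∞ g}.indicator 1 s := by
                refine lintegral_mono_ae ?_
                filter_upwards [ae_restrict_mem measurableSet_Ioi,
                  -- The critical level `s = ‖g‖_∞` is discarded as a null set: `{g > s}` is known
                  -- to have zero content only for `s` strictly above the norm.
                  ae_restrict_of_ae (Measure.ae_ne volume (choquetNorm d ∞ g).toReal)] with s hs hne
                rcases lt_trichotomy (ENNReal.ofReal s) (choquetNorm d ∞ g) with h | h | h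
                · simp [h]
                · exact absurd (by rw [← h, ENNReal.toReal_ofReal (le_of_lt hs)]) hne
                · simp [dyadicContent_eq_zero_of_choquetNorm_top_lt h]
            _ = _ := by
                rw [lintegral_const_mul _ (measurable_one.indicator
                  (measurableSet_lt ENNReal.measurable_ofReal measurable_const)),
                  lintegral_indicator_ofReal_lt]
      _ = _ := by
          rw [lintegral_mul_const _ hF, choquetNorm_of_ne_top ENNReal.one_ne_top]
          simp [choquetIntegral]
  · have h := ENNReal.HolderConjugate.toReal_of_ne_top hp_top hp'
    rw [lintegral_lintegral_min hF hG, choquetNorm_of_ne_top hp_top, choquetNorm_of_ne_top hp']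
    refine (ENNReal.lintegral_mul_le_Lp_mul_Lq _ h (measurable_rearrangement hF).aemeasurable
      (measurable_rearrangement hG).aemeasurable).trans ?_
    gcongr
    · exact lintegral_rearrangement_rpow_le f h.pos
    · exact lintegral_rearrangement_rpow_le g h.symm.pos

end Choquet

/-! ### Self-adjointness and growth of the sparse operator -/

section SparseOperator

variable {n : ℕ} {S : Set (DyadicCube n)}

theorem setLAverage_mul_volume (Q : DyadicCube n) (f : (Fin n → ℝ) → ℝ≥0∞) :
    (⨍⁻ y in Q.toSet, f y ∂volume) * volume Q.toSet = ∫⁻ y in Q.toSet, f y := by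
  rw [setLAverage_eq, ENNReal.div_mul_cancel Q.volume_toSet_ne_zero Q.volume_toSet_ne_top]

theorem measurable_sparseOperatorENN (S : Set (DyadicCube n)) (f : (Fin n → ℝ) → ℝ≥0∞) :
    Measurable (sparseOperatorENN S f) :=
  Measurable.tsum fun Q =>
    measurable_const.indicator (Q : DyadicCube n).measurableSet_toSet

theorem lintegral_sparseOperatorENN_mul (f : (Fin n → ℝ) → ℝ≥0∞) {g : (Fin n → ℝ) → ℝ≥0∞}
    (hg : AEMeasurable g volume) :
    ∫⁻ x, sparseOperatorENN S f x * g x =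
      ∑' Q : S, (⨍⁻ y in (Q : DyadicCube n).toSet, f y ∂volume) *
        ∫⁻ y in (Q : DyadicCube n).toSet, g y := by
  simp_rw [sparseOperatorENN, ← ENNReal.tsum_mul_right]
  rw [lintegral_tsum]
  swap
  · exact fun Q => (measurable_const.indicator
      (Q : DyadicCube n).measurableSet_toSet).aemeasurable.mul hg
  refine tsum_congr fun Q => ?_
  have hm := (Q : DyadicCube n).measurableSet_toSet
  rw [← lintegral_const_mul'' _ hg.restrict, ← lintegral_indicator hm]
  refine lintegral_congr fun x => ?_
  by_cases hx : x ∈ (Q : DyadicCube n).toSet <;> simp [hx]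

/-- The sparse operator is self-adjoint. -/
theorem lintegral_sparseOperatorENN_mul_comm {f g : (Fin n → ℝ) → ℝ≥0∞}
    (hf : AEMeasurable f volume) (hg : AEMeasurable g volume) :
    ∫⁻ x, sparseOperatorENN S f x * g x = ∫⁻ x, sparseOperatorENN S g x * f x := by
  rw [lintegral_sparseOperatorENN_mul f hg, lintegral_sparseOperatorENN_mul g hf]
  refine tsum_congr fun Q => ?_
  rw [setLAverage_eq, setLAverage_eq, ENNReal.div_eq_inv_mul, ENNReal.div_eq_inv_mul]
  ring

/-- A Carleson packing bound for `v` bounds the measure with density `A_S v` on cubes. -/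
theorem setLIntegral_sparseOperatorENN_le {d : ℝ} {v W : (Fin n → ℝ) → ℝ≥0∞}
    {a : DyadicCube n → ℝ≥0∞} {K : ℝ≥0∞}
    (hcar : ∀ R : DyadicCube n, ∑' Q : {Q // Q ∈ S ∧ Q.Sub R},
      ∫⁻ y in (Q : DyadicCube n).toSet, v y ≤ K * volume R.toSet * a R)
    (havg : ∀ Q : DyadicCube n, ∫⁻ y in Q.toSet, v y ≤ volume Q.toSet * a Q)
    (hW : ∀ Q : DyadicCube n, ∀ x ∈ Q.toSet, Q.len ^ ((n : ℝ) - d) * a Q ≤ W x)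
    (R : DyadicCube n) {x : Fin n → ℝ} (hx : x ∈ R.toSet) :
    ∫⁻ y in R.toSet, sparseOperatorENN S v y ≤
      (K + (1 - (2 : ℝ≥0∞) ^ (-((n : ℝ) - d)))⁻¹) * R.len ^ d * W x := by
  set s : ℝ := (n : ℝ) - d with hs
  let A : Set (DyadicCube n) := {Q | Q ∈ S ∧ Q.Sub R}
  -- Membership in `S` is dropped here: over strict ancestors the geometric decay suffices, and the
  -- packing hypothesis serves only the subcubes of `R`.
  let B : Set (DyadicCube n) := {Q | Q.scale < R.scale ∧ x ∈ Q.toSet}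
  let ψ : DyadicCube n → ℝ≥0∞ := fun Q => ∫⁻ y in Q.toSet, v y
  let χ : DyadicCube n → ℝ≥0∞ := fun Q => Q.len ^ (-s) * (volume R.toSet * W x)
  have hR : volume R.toSet = R.len ^ d * R.len ^ s := by
    rw [R.volume_toSet, ← ENNReal.rpow_add _ _ R.len_ne_zero R.len_ne_top, hs]
    congr 1
    ring
  have hcancel (Q : DyadicCube n) : Q.len ^ (-s) * Q.len ^ s = 1 := by
    rw [← ENNReal.rpow_add _ _ Q.len_ne_zero Q.len_ne_top]
    simp
  have hpt (Q : DyadicCube n) :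
      S.indicator (fun Q => (⨍⁻ y in Q.toSet, v y ∂volume) * volume (Q.toSet ∩ R.toSet)) Q ≤
        A.indicator ψ Q + B.indicator χ Q := by
    by_cases hQ : Q ∈ S
    swap
    · simp [hQ]
    rw [Set.indicator_of_mem hQ]
    rcases Q.sub_or_lt_or_disjoint R with h | ⟨h, hsub⟩ | h
    · rw [Set.indicator_of_mem (show Q ∈ A from ⟨hQ, h⟩)]
      refine le_add_right ?_
      calc _ ≤ (⨍⁻ y in Q.toSet, v y ∂volume) * volume Q.toSet := by
            gcongr
            exact Set.inter_subset_left
        _ = _ := setLAverage_mul_volume Q v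
    · rw [Set.indicator_of_mem (show Q ∈ B from ⟨h, hsub hx⟩)]
      refine le_add_left ?_
      calc (⨍⁻ y in Q.toSet, v y ∂volume) * volume (Q.toSet ∩ R.toSet)
          ≤ a Q * volume R.toSet := by
            gcongr
            · rw [setLAverage_eq]
              exact ENNReal.div_le_of_le_mul' (havg Q)
            · exact Set.inter_subset_right
        _ = Q.len ^ (-s) * (volume R.toSet * (Q.len ^ s * a Q)) := by
            rw [mul_left_comm, ← mul_assoc (Q.len ^ (-s)), hcancel, one_mul, mul_comm]
        _ ≤ Q.len ^ (-s) * (volume R.toSet * W x) := by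
            gcongr
            exact hW Q x (hsub hx)
    · simp [Set.disjoint_iff_inter_eq_empty.1 h]
  have hform : ∫⁻ y in R.toSet, sparseOperatorENN S v y =
      ∑' Q : S, (⨍⁻ y in (Q : DyadicCube n).toSet, v y ∂volume) *
        volume ((Q : DyadicCube n).toSet ∩ R.toSet) := by
    have h := lintegral_sparseOperatorENN_mul (S := S) v (g := R.toSet.indicator 1)
      (measurable_one.indicator R.measurableSet_toSet).aemeasurable
    rw [← lintegral_indicator R.measurableSet_toSet]
    calc _ = ∫⁻ y, sparseOperatorENN S v y * R.toSet.indicator 1 y := by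
          refine lintegral_congr fun y => ?_
          by_cases hy : y ∈ R.toSet <;> simp [hy]
      _ = _ := h.trans (tsum_congr fun Q => by
          rw [lintegral_indicator_one R.measurableSet_toSet,
            Measure.restrict_apply R.measurableSet_toSet, Set.inter_comm])
  calc ∫⁻ y in R.toSet, sparseOperatorENN S v y
      = ∑' Q, S.indicator
          (fun Q => (⨍⁻ y in Q.toSet, v y ∂volume) * volume (Q.toSet ∩ R.toSet)) Q := by
        rw [hform]
        exact tsum_subtype S
          fun Q => (⨍⁻ y in Q.toSet, v y ∂volume) * volume (Q.toSet ∩ R.toSet)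
    _ ≤ ∑' Q, (A.indicator ψ Q + B.indicator χ Q) := ENNReal.tsum_le_tsum hpt
    _ = ∑' Q : A, ψ Q + ∑' Q : B, χ Q := by
        rw [ENNReal.tsum_add, tsum_subtype, tsum_subtype]
    _ ≤ K * volume R.toSet * a R +
          (1 - (2 : ℝ≥0∞) ^ (-s))⁻¹ * R.len ^ (-s) * (volume R.toSet * W x) := by
        refine add_le_add (hcar R) ?_
        rw [ENNReal.tsum_mul_right]
        gcongr
        exact R.tsum_ancestors_len_rpow_le x
    _ = K * R.len ^ d * (R.len ^ s * a R) +
          (1 - (2 : ℝ≥0∞) ^ (-s))⁻¹ * R.len ^ d * W x * (R.len ^ (-s) * R.len ^ s) := by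
        rw [hR]
        ring
    _ ≤ K * R.len ^ d * W x + (1 - (2 : ℝ≥0∞) ^ (-s))⁻¹ * R.len ^ d * W x * 1 := by
        rw [hcancel]
        gcongr
        exact hW R x hx
    _ = _ := by ring

end SparseOperator

/-! ### Carleson packing in `L log L` -/

section Orlicz

variable {n : ℕ} {S : Set (DyadicCube n)} {η : ℝ}

theorem tsum_measure_le_of_pairwiseDisjoint {E : DyadicCube n → Set (Fin n → ℝ)}
    {F : Set (DyadicCube n)} (hE : ∀ Q ∈ F, NullMeasurableSet (E Q) volume ∧ E Q ⊆ Q.toSet)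
    (hdisj : F.PairwiseDisjoint E) :
    ∑' Q : F, volume (E Q) ≤ volume (⋃ Q ∈ F, Q.toSet) := by
  rw [← measure_biUnion₀ F.to_countable (fun Q hQ Q' hQ' h => (hdisj hQ hQ' h).aedisjoint)
    fun Q hQ => (hE Q hQ).1]
  exact measure_mono (Set.iUnion₂_mono fun Q hQ => (hE Q hQ).2)

/-- For `2w > 1` the integral is `2 log (2w)`, and `2w ≤ (e + w)^2`. This is the source of the
logarithm in `Φ₀`. -/
theorem lintegral_Ioi_one_indicator_two_div_le (w : ℝ≥0) :
    ∫⁻ t in Set.Ioi (1 : ℝ), {t : ℝ | t < 2 * w}.indicator (fun t => ENNReal.ofReal (2 / t)) t ≤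
      ENNReal.ofReal (4 * Real.log (Real.exp 1 + w)) := by
  have hw : (0 : ℝ) ≤ w := w.2
  have hm : MeasurableSet {t : ℝ | t < 2 * w} := measurableSet_Iio
  rw [setLIntegral_indicator hm]
  rcases le_or_gt (2 * (w : ℝ)) 1 with h | h
  · have : {t : ℝ | t < 2 * w} ∩ Set.Ioi 1 = ∅ := by
      ext t
      simp only [Set.mem_inter_iff, Set.mem_Ioi, Set.mem_empty_iff_false, iff_false,
        not_and, not_lt]
      intro (ht : t < 2 * w)
      linarith
    simp [this]
  · have hset : {t : ℝ | t < 2 * w} ∩ Set.Ioi 1 ⊆ Set.Ioc 1 (2 * w) :=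
      fun t ht => ⟨ht.2, le_of_lt ht.1⟩
    refine (lintegral_mono_set hset).trans ?_
    have hint : IntervalIntegrable (fun t : ℝ => 2 / t) volume 1 (2 * w) := by
      refine ContinuousOn.intervalIntegrable ?_
      refine continuousOn_const.div continuousOn_id fun t ht => ?_
      rw [Set.uIcc_of_le h.le] at ht
      exact (zero_lt_one.trans_le ht.1).ne'
    rw [← ofReal_integral_eq_lintegral_ofReal
      ((intervalIntegrable_iff_integrableOn_Ioc_of_le h.le).1 hint)]
    · refine ENNReal.ofReal_le_ofReal ?_
      rw [← intervalIntegral.integral_of_le h.le]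
      simp_rw [div_eq_mul_inv]
      rw [intervalIntegral.integral_const_mul, integral_inv_of_pos one_pos (by linarith), div_one]
      have h1 : Real.log (2 * w) ≤ Real.log ((Real.exp 1 + w) ^ 2) := by
        refine Real.log_le_log (by linarith) ?_
        have := Real.add_one_le_exp 1
        nlinarith
      rw [Real.log_pow] at h1
      push_cast at h1
      linarith
    · filter_upwards [ae_restrict_mem measurableSet_Ioc] with t ht
      exact div_nonneg zero_le_two (zero_le_one.trans ht.1.le)

theorem le_one_add_lintegral_Ioi_one (a : ℝ≥0∞) :
    a ≤ 1 + ∫⁻ t in Set.Ioi (1 : ℝ), {t | ENNReal.ofReal t < a}.indicator (fun _ => 1) t := by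
  calc a = ∫⁻ t in Set.Ioi (0 : ℝ), {t | ENNReal.ofReal t < a}.indicator (fun _ => 1) t :=
        (lintegral_indicator_ofReal_lt a).symm
    _ ≤ (∫⁻ t in Set.Ioc (0 : ℝ) 1, {t | ENNReal.ofReal t < a}.indicator (fun _ => 1) t) +
        ∫⁻ t in Set.Ioi (1 : ℝ), {t | ENNReal.ofReal t < a}.indicator (fun _ => 1) t := by
        rw [← Set.Ioc_union_Ioi_eq_Ioi zero_le_one]
        exact lintegral_union_le _ _ _
    _ ≤ _ := by
        gcongr
        calc _ ≤ ∫⁻ t in Set.Ioc (0 : ℝ) 1, (1 : ℝ≥0∞) :=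
              lintegral_mono fun t => Set.indicator_le_self' (by simp) t
          _ = 1 := by simp

theorem le_Phi0 (t : ℝ≥0) : (t : ℝ≥0∞) ≤ Phi0 t := by
  rw [Phi0, ← ENNReal.ofReal_coe_nnreal]
  refine ENNReal.ofReal_le_ofReal (le_mul_of_one_le_right t.2 ?_)
  rw [Real.le_log_iff_exp_le (by positivity)]
  exact le_add_of_nonneg_right t.2

/-- The part of `u` not exceeding `t/2` accounts for at most half of an average above `t`, so `{u >
t/2}` carries the rest. Summed over disjoint cubes, this is the truncated weak-type estimate for the
dyadic maximal function. -/
theorem volume_le_of_lt_setLAverage {u : (Fin n → ℝ) → ℝ≥0} {Q : DyadicCube n}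
    {t : ℝ} (ht : 0 < t) (h : ENNReal.ofReal t < ⨍⁻ y in Q.toSet, (u y : ℝ≥0∞) ∂volume) :
    volume Q.toSet ≤ ∫⁻ y in Q.toSet, (u y : ℝ≥0∞) *
      {t : ℝ | t < 2 * u y}.indicator (fun t => ENNReal.ofReal (2 / t)) t := by
  set I := ∫⁻ y in Q.toSet, (u y : ℝ≥0∞) *
      {t : ℝ | t < 2 * u y}.indicator (fun t => ENNReal.ofReal (2 / t)) t
  have hc : ENNReal.ofReal (t / 2) ≠ 0 := by simpa using ht
  have hpt (y : Fin n → ℝ) : (u y : ℝ≥0∞) ≤ ENNReal.ofReal (t / 2) * ((u y : ℝ≥0∞) *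
      {t : ℝ | t < 2 * u y}.indicator (fun t => ENNReal.ofReal (2 / t)) t) +
        ENNReal.ofReal (t / 2) := by
    by_cases hy : t < 2 * u y
    · rw [Set.indicator_of_mem (by exact hy), mul_left_comm,
        ← ENNReal.ofReal_mul (by positivity)]
      have : t / 2 * (2 / t) = 1 := by field_simp
      simp [this]
    · refine le_add_left ?_
      rw [← ENNReal.ofReal_coe_nnreal]
      exact ENNReal.ofReal_le_ofReal (by linarith)
  have h1 : ENNReal.ofReal t * volume Q.toSet ≤
      ENNReal.ofReal (t / 2) * I + ENNReal.ofReal (t / 2) * volume Q.toSet := by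
    calc _ ≤ ∫⁻ y in Q.toSet, (u y : ℝ≥0∞) := by
          rw [← setLAverage_mul_volume]
          gcongr
      _ ≤ ∫⁻ y in Q.toSet, (ENNReal.ofReal (t / 2) * ((u y : ℝ≥0∞) *
            {t : ℝ | t < 2 * u y}.indicator (fun t => ENNReal.ofReal (2 / t)) t) +
              ENNReal.ofReal (t / 2)) := lintegral_mono hpt
      _ = _ := by
          rw [lintegral_add_right _ measurable_const, setLIntegral_const,
            lintegral_const_mul' _ _ ENNReal.ofReal_ne_top]
  have h2 : ENNReal.ofReal t * volume Q.toSet =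
      ENNReal.ofReal (t / 2) * volume Q.toSet + ENNReal.ofReal (t / 2) * volume Q.toSet := by
    rw [← add_mul, ← ENNReal.ofReal_add (by positivity) (by positivity), add_halves]
  rw [h2, ENNReal.add_le_add_iff_right
    (ENNReal.mul_ne_top ENNReal.ofReal_ne_top Q.volume_toSet_ne_top)] at h1
  exact (ENNReal.mul_le_mul_iff_right hc ENNReal.ofReal_ne_top).1 h1

/-- The `L log L` packing estimate for a sparse family. -/
theorem IsSparseFamily.tsum_setLIntegral_le (hS : IsSparseFamily η S) (hη : 0 < η)
    {u : (Fin n → ℝ) → ℝ≥0} (hu : Measurable u) {R : DyadicCube n}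
    (h : ∫⁻ y in R.toSet, Phi0 (u y) ≤ volume R.toSet) :
    ∑' Q : {Q // Q ∈ S ∧ Q.Sub R}, ∫⁻ y in (Q : DyadicCube n).toSet, (u y : ℝ≥0∞) ≤
      5 * (ENNReal.ofReal η)⁻¹ * volume R.toSet := by
  obtain ⟨E, hE, hdisj⟩ := hS
  let A : Set (DyadicCube n) := {Q | Q ∈ S ∧ Q.Sub R}
  let m : DyadicCube n → ℝ≥0∞ := fun Q => ⨍⁻ y in Q.toSet, (u y : ℝ≥0∞) ∂volume
  let k : (Fin n → ℝ) → ℝ → ℝ≥0∞ := fun y t =>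
    (u y : ℝ≥0∞) * {t : ℝ | t < 2 * u y}.indicator (fun t => ENNReal.ofReal (2 / t)) t
  have hk : Measurable (Function.uncurry k) := by
    refine (hu.coe_nnreal_ennreal.comp measurable_fst).mul ?_
    have hms : MeasurableSet {z : (Fin n → ℝ) × ℝ | z.2 < 2 * u z.1} :=
      measurableSet_lt measurable_snd ((hu.coe_nnreal_real.comp measurable_fst).const_mul 2)
    exact (ENNReal.measurable_ofReal.comp (measurable_snd.const_div 2)).indicator hms
  have hη0 : ENNReal.ofReal η ≠ 0 := by simpa using hη
  have hsub {F : Set (DyadicCube n)} (hF : F ⊆ A) :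
      ∑' Q : F, volume (E Q) ≤ volume (⋃ Q ∈ F, Q.toSet) :=
    tsum_measure_le_of_pairwiseDisjoint (fun Q hQ => ⟨(hE Q (hF hQ).1).1, (hE Q (hF hQ).1).2.1⟩)
      (hdisj.subset fun Q hQ => (hF hQ).1)
  have h1 : ∑' Q : A, volume (E Q) ≤ volume R.toSet :=
    (hsub le_rfl).trans (measure_mono (Set.iUnion₂_subset fun Q hQ => hQ.2.2))
  -- Disjointness of the `E Q` bounds the sum by the volume of the union of cubes with average above
  -- `t`; its maximal cubes are then estimated one by one.
  have hlevel {t : ℝ} (ht : 1 < t) :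
      ∑' Q : A, {t | ENNReal.ofReal t < m Q}.indicator (fun _ => 1) t * volume (E Q) ≤
        ∫⁻ y in R.toSet, k y t := by
    let F : Set (DyadicCube n) := {Q | Q ∈ A ∧ ENNReal.ofReal t < m Q}
    calc _ = ∑' Q : F, volume (E Q) := by
          rw [tsum_subtype F (fun Q => volume (E Q)), tsum_subtype A
            (fun Q => {t | ENNReal.ofReal t < m Q}.indicator (fun _ => 1) t * volume (E Q))]
          refine tsum_congr fun Q => ?_
          by_cases hA : Q ∈ A <;> by_cases hm : ENNReal.ofReal t < m Q <;>
            simp [F, hA, hm]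
      _ ≤ volume (⋃ Q ∈ F, Q.toSet) := hsub fun Q hQ => hQ.1
      _ ≤ (volume.withDensity fun y => k y t) R.toSet := by
          refine DyadicCube.measure_biUnion_le_of_forall_le (fun Q hQ => hQ.1.2) fun Q hQ => ?_
          rw [withDensity_apply _ Q.measurableSet_toSet]
          exact volume_le_of_lt_setLAverage (one_pos.trans ht) hQ.2
      _ = _ := withDensity_apply _ R.measurableSet_toSet
  -- The constant is `1 + 4`: levels `t ≤ 1` give `|R|` by disjointness, levels `t > 1` give `4 ∫
  -- Φ₀(u)`.
  have hmain : ∑' Q : A, m Q * volume (E Q) ≤ 5 * volume R.toSet := by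
    calc ∑' Q : A, m Q * volume (E Q)
        ≤ ∑' Q : A, (volume (E Q) + ∫⁻ t in Set.Ioi (1 : ℝ),
            {t | ENNReal.ofReal t < m Q}.indicator (fun _ => 1) t * volume (E Q)) := by
          refine ENNReal.tsum_le_tsum fun Q => ?_
          rw [lintegral_mul_const _ (measurable_const.indicator
            (measurableSet_lt ENNReal.measurable_ofReal measurable_const))]
          calc _ ≤ _ := mul_le_mul_left (le_one_add_lintegral_Ioi_one (m Q)) _
            _ = _ := by rw [add_mul, one_mul]
      _ = ∑' Q : A, volume (E Q) + ∫⁻ t in Set.Ioi (1 : ℝ),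
            ∑' Q : A, {t | ENNReal.ofReal t < m Q}.indicator (fun _ => 1) t * volume (E Q) := by
          rw [ENNReal.tsum_add, lintegral_tsum]
          exact fun Q => ((measurable_const.indicator
            (measurableSet_lt ENNReal.measurable_ofReal measurable_const)).mul_const _).aemeasurable
      _ ≤ volume R.toSet + ∫⁻ t in Set.Ioi (1 : ℝ), ∫⁻ y in R.toSet, k y t := by
          refine add_le_add h1 (setLIntegral_mono' measurableSet_Ioi fun t ht => hlevel ht)
      _ = volume R.toSet + ∫⁻ y in R.toSet, ∫⁻ t in Set.Ioi (1 : ℝ), k y t := by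
          rw [lintegral_lintegral_swap hk.aemeasurable]
      _ ≤ volume R.toSet + ∫⁻ y in R.toSet, 4 * Phi0 (u y) := by
          gcongr with y
          rw [lintegral_const_mul' _ _ ENNReal.coe_ne_top]
          calc _ ≤ (u y : ℝ≥0∞) * ENNReal.ofReal (4 * Real.log (Real.exp 1 + u y)) := by
                gcongr
                exact lintegral_Ioi_one_indicator_two_div_le _
            _ = _ := by
                rw [Phi0, ENNReal.ofReal_mul (by norm_num), ENNReal.ofReal_mul NNReal.zero_le_coe,
                  ENNReal.ofReal_coe_nnreal, ENNReal.ofReal_ofNat]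
                ring
      _ ≤ volume R.toSet + 4 * volume R.toSet := by
          rw [lintegral_const_mul' _ _ (by simp)]
          gcongr
      _ = _ := by ring
  calc ∑' Q : {Q // Q ∈ S ∧ Q.Sub R}, ∫⁻ y in (Q : DyadicCube n).toSet, (u y : ℝ≥0∞)
      ≤ ∑' Q : A, (ENNReal.ofReal η)⁻¹ * (m Q * volume (E Q)) := by
        refine ENNReal.tsum_le_tsum fun Q => ?_
        rw [← setLAverage_mul_volume, mul_left_comm]
        gcongr
        rw [← ENNReal.div_eq_inv_mul, ENNReal.le_div_iff_mul_le (.inl hη0)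
          (.inl ENNReal.ofReal_ne_top), mul_comm]
        exact (hE Q Q.2.1).2.2
    _ = (ENNReal.ofReal η)⁻¹ * ∑' Q : A, m Q * volume (E Q) := ENNReal.tsum_mul_left
    _ ≤ (ENNReal.ofReal η)⁻¹ * (5 * volume R.toSet) := by gcongr
    _ = _ := by ring

end Orlicz

/-! ### The Orlicz maximal function and the duality estimate -/

section OrliczMaximal

variable {n : ℕ} {S : Set (DyadicCube n)} {d η : ℝ}

theorem orliczAverage_congr_ae {Φ : ℝ≥0 → ℝ≥0∞} {g g' : (Fin n → ℝ) → ℝ} (h : g =ᵐ[volume] g')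
    (Q : DyadicCube n) : orliczAverage Φ Q g = orliczAverage Φ Q g' := by
  unfold orliczAverage
  have (c : ℝ≥0) : ⨍⁻ x in Q.toSet, Φ (‖g x‖₊ / c) ∂volume =
      ⨍⁻ x in Q.toSet, Φ (‖g' x‖₊ / c) ∂volume := by
    refine laverage_congr ?_
    filter_upwards [ae_restrict_of_ae h] with x hx
    rw [hx]
  simp_rw [this]

theorem orliczMaximal_congr_ae {α : ℝ} {Φ : ℝ≥0 → ℝ≥0∞} {g g' : (Fin n → ℝ) → ℝ}
    (h : g =ᵐ[volume] g') : orliczMaximal α Φ g = orliczMaximal α Φ g' := by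
  unfold orliczMaximal
  simp_rw [orliczAverage_congr_ae h]

theorem measurable_orliczMaximal (α : ℝ) (Φ : ℝ≥0 → ℝ≥0∞) (g : (Fin n → ℝ) → ℝ) :
    Measurable (orliczMaximal α Φ g) :=
  Measurable.iSup fun Q => measurable_const.indicator Q.measurableSet_toSet

theorem len_rpow_mul_orliczAverage_le_orliczMaximal (α : ℝ) (Φ : ℝ≥0 → ℝ≥0∞)
    (g : (Fin n → ℝ) → ℝ) {Q : DyadicCube n} {x : Fin n → ℝ} (hx : x ∈ Q.toSet) :
    Q.len ^ α * orliczAverage Φ Q g ≤ orliczMaximal α Φ g x := by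
  refine le_trans ?_ (le_iSup _ Q)
  rw [Set.indicator_of_mem hx, DyadicCube.len]

/-- Reduces bounds by a Luxemburg norm to admissible `c`. Nonvanishing of `M` covers the case
without admissible `c`, where the norm is `∞`. -/
theorem le_mul_orliczAverage {Φ : ℝ≥0 → ℝ≥0∞} {g : (Fin n → ℝ) → ℝ} {Q : DyadicCube n}
    {X M : ℝ≥0∞} (hM0 : M ≠ 0) (hM : M ≠ ∞)
    (h : ∀ c : ℝ≥0, 0 < c → ∫⁻ x in Q.toSet, Φ (‖g x‖₊ / c) ≤ volume Q.toSet → X ≤ M * c) :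
    X ≤ M * orliczAverage Φ Q g := by
  rw [mul_comm, ← ENNReal.div_le_iff hM0 hM]
  refine le_iInf fun c => le_iInf fun hc => le_iInf fun hle => ?_
  rw [ENNReal.div_le_iff hM0 hM, mul_comm]
  refine h c hc ?_
  rw [← setLAverage_mul_volume]
  exact mul_le_of_le_one_left' hle

theorem setLIntegral_enorm_eq_mul (g : (Fin n → ℝ) → ℝ) {c : ℝ≥0} (hc : 0 < c)
    (s : Set (Fin n → ℝ)) :
    ∫⁻ y in s, ‖g y‖ₑ = (∫⁻ y in s, ((‖g y‖₊ / c : ℝ≥0) : ℝ≥0∞)) * c := by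
  rw [← lintegral_mul_const' _ _ ENNReal.coe_ne_top]
  refine lintegral_congr fun y => ?_
  rw [← ENNReal.coe_mul, div_mul_cancel₀ _ hc.ne']
  rfl

theorem setLIntegral_enorm_le_mul_orliczAverage (g : (Fin n → ℝ) → ℝ) (Q : DyadicCube n) :
    ∫⁻ y in Q.toSet, ‖g y‖ₑ ≤ volume Q.toSet * orliczAverage Phi0 Q g := by
  refine le_mul_orliczAverage Q.volume_toSet_ne_zero Q.volume_toSet_ne_top fun c hc h => ?_
  rw [setLIntegral_enorm_eq_mul g hc]
  gcongr
  exact (lintegral_mono fun y => le_Phi0 _).trans h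

theorem IsSparseFamily.tsum_setLIntegral_enorm_le (hS : IsSparseFamily η S) (hη : 0 < η)
    {g : (Fin n → ℝ) → ℝ} (hg : Measurable g) (R : DyadicCube n) :
    ∑' Q : {Q // Q ∈ S ∧ Q.Sub R}, ∫⁻ y in (Q : DyadicCube n).toSet, ‖g y‖ₑ ≤
      5 * (ENNReal.ofReal η)⁻¹ * volume R.toSet * orliczAverage Phi0 R g := by
  have hη0 : ENNReal.ofReal η ≠ 0 := by simpa using hη
  refine le_mul_orliczAverage
    (mul_ne_zero (mul_ne_zero (by simp) (by simp)) R.volume_toSet_ne_zero)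
    (ENNReal.mul_ne_top (ENNReal.mul_ne_top (by simp) (by simp [hη0])) R.volume_toSet_ne_top)
    fun c hc h => ?_
  simp_rw [setLIntegral_enorm_eq_mul g hc]
  rw [ENNReal.tsum_mul_right]
  gcongr
  exact hS.tsum_setLIntegral_le hη (hg.nnnorm.div_const c) h

/-- The constant in the sparse bound. -/
noncomputable def sparseConst (n : ℕ) (d η : ℝ) : ℝ≥0∞ :=
  5 * (ENNReal.ofReal η)⁻¹ + (1 - (2 : ℝ≥0∞) ^ (-((n : ℝ) - d)))⁻¹

theorem sparseConst_ne_zero : sparseConst n d η ≠ 0 := by simp [sparseConst]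

theorem sparseConst_ne_top (hdn : d < n) (hη : 0 < η) : sparseConst n d η ≠ ∞ := by
  have := DyadicCube.inv_one_sub_two_rpow_ne_top (sub_pos.2 hdn)
  exact ENNReal.add_ne_top.2 ⟨ENNReal.mul_ne_top (by simp) (by simpa using hη), this⟩

theorem IsSparseFamily.associateNorm_sparseOperatorENN_le (hS : IsSparseFamily η S) (hη : 0 < η)
    (hd : 0 < d) (hdn : d < n) {p p' : ℝ≥0∞} (hp_top : p ≠ ∞)
    (hpp' : ENNReal.HolderConjugate p p') {f : (Fin n → ℝ) → ℝ≥0∞} (hf : AEMeasurable f volume) :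
    associateNorm (orliczMorreyNorm d p' Phi0) (sparseOperatorENN S f) ≤
      4 * sparseConst n d η * choquetNorm d p f := by
  refine iSup_le fun g => iSup_le fun hg => iSup_le fun hN => ?_
  -- The maximal function depends only on the almost everywhere class of `g`, so the norm constraint
  -- survives the change of representative.
  wlog hgm : Measurable g generalizing g
  · have hae := hg.ae_eq_mk
    rw [lintegral_congr_ae (g := fun x => sparseOperatorENN S f x * ‖hg.mk g x‖ₑ)
      (by filter_upwards [hae] with x hx; rw [hx])]
    refine this _ hg.measurable_mk.aemeasurable ?_ hg.measurable_mk
    rwa [orliczMorreyNorm, ← orliczMaximal_congr_ae hae]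
  set W := orliczMaximal ((n : ℝ) - d) Phi0 g
  set h := sparseOperatorENN S fun x => ‖g x‖ₑ
  have hh : Measurable h := measurable_sparseOperatorENN S _
  have hac : (volume : Measure (Fin n → ℝ)).withDensity h ≪ volume :=
    withDensity_absolutelyContinuous _ _
  calc ∫⁻ x, sparseOperatorENN S f x * ‖g x‖ₑ = ∫⁻ x, h x * f x :=
        lintegral_sparseOperatorENN_mul_comm hf hg.enorm
    _ = ∫⁻ x, f x ∂(volume.withDensity h) :=
        (lintegral_withDensity_eq_lintegral_mul₀ hh.aemeasurable hf).symm
    _ ≤ 4 * sparseConst n d η * ∫⁻ t in Set.Ioi (0 : ℝ), ∫⁻ s in Set.Ioi (0 : ℝ),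
          min (dyadicContent d {x | ENNReal.ofReal t < f x})
            (dyadicContent d {x | ENNReal.ofReal s < W x}) := by
        refine lintegral_le_lintegral_lintegral_min hd hdn.le hac (measurable_orliczMaximal _ _ _)
          sparseConst_ne_zero (sparseConst_ne_top hdn hη) (fun Q x hx => ?_) (hf.mono_ac hac)
        rw [withDensity_apply _ Q.measurableSet_toSet]
        exact setLIntegral_sparseOperatorENN_le (a := fun Q => orliczAverage Phi0 Q g)
          (hS.tsum_setLIntegral_enorm_le hη hgm) (setLIntegral_enorm_le_mul_orliczAverage g)
          (fun Q x hx => len_rpow_mul_orliczAverage_le_orliczMaximal _ _ _ hx) Q hx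
    _ ≤ 4 * sparseConst n d η * (choquetNorm d p f * choquetNorm d p' W) := by
        gcongr
        exact lintegral_lintegral_min_le_choquetNorm_mul hp_top hpp' f W
    _ ≤ 4 * sparseConst n d η * (choquetNorm d p f * 1) := by
        gcongr
        exact hN
    _ = _ := by rw [mul_one]

end OrliczMaximal

/-! ### Measurability and integrability in the Choquet space -/

section ChoquetSpace

variable {n : ℕ} {d : ℝ}

theorem lintegral_Ioi_comp_mul_left {F : ℝ → ℝ≥0∞} (hF : Measurable F) {b : ℝ} (hb : 0 < b) :
    ENNReal.ofReal b * ∫⁻ t in Set.Ioi (0 : ℝ), F (b * t) = ∫⁻ t in Set.Ioi (0 : ℝ), F t := by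
  have hm : Measurable ((Set.Ioi (0 : ℝ)).indicator F) := hF.indicator measurableSet_Ioi
  rw [← lintegral_indicator measurableSet_Ioi, ← lintegral_indicator measurableSet_Ioi]
  conv_rhs => rw [← Real.smul_map_volume_mul_left hb.ne', lintegral_smul_measure, abs_of_pos hb,
    lintegral_map hm (measurable_const_mul b)]
  rw [smul_eq_mul]
  congr 1
  refine lintegral_congr fun t => ?_
  by_cases ht : 0 < t
  · have : 0 < b * t := mul_pos hb ht
    simp [ht, this]
  · have : ¬ 0 < b * t := fun h => ht (pos_of_mul_pos_right h hb.le)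
    simp [ht, this]

theorem choquetIntegral_mono {f g : (Fin n → ℝ) → ℝ≥0∞} (h : ∀ x, f x ≤ g x) :
    choquetIntegral d f ≤ choquetIntegral d g :=
  lintegral_mono fun _ => dyadicContent_mono fun x hx => hx.trans_le (h x)

theorem ofReal_mul_dyadicContent_le_choquetIntegral (f : (Fin n → ℝ) → ℝ≥0∞) (t : ℝ) :
    ENNReal.ofReal t * dyadicContent d {x | ENNReal.ofReal t < f x} ≤ choquetIntegral d f := by
  calc _ = ∫⁻ _ in Set.Ioo (0 : ℝ) t, dyadicContent d {x | ENNReal.ofReal t < f x} := by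
        rw [setLIntegral_const, Real.volume_Ioo, sub_zero, mul_comm]
    _ ≤ ∫⁻ s in Set.Ioo (0 : ℝ) t, dyadicContent d {x | ENNReal.ofReal s < f x} :=
        setLIntegral_mono' measurableSet_Ioo fun s hs =>
          antitone_dyadicContent_ofReal_lt f hs.2.le
    _ ≤ _ := lintegral_mono_set fun s hs => hs.1

theorem choquetIntegral_const_mul_lt_top {a : ℝ} (ha : 0 < a) {f : (Fin n → ℝ) → ℝ≥0∞}
    (hf : choquetIntegral d f < ∞) : choquetIntegral d (fun x => ENNReal.ofReal a * f x) < ∞ := by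
  have h := lintegral_Ioi_comp_mul_left
    (antitone_dyadicContent_ofReal_lt (d := d) f).measurable (inv_pos.2 ha)
  have h2 : choquetIntegral d (fun x => ENNReal.ofReal a * f x) = ∫⁻ t in Set.Ioi (0 : ℝ),
      dyadicContent d {x | ENNReal.ofReal (a⁻¹ * t) < f x} := by
    refine lintegral_congr fun t => ?_
    congr 1
    ext x
    have ha0 : ENNReal.ofReal a ≠ 0 := by simpa using ha
    change ENNReal.ofReal t < ENNReal.ofReal a * f x ↔ ENNReal.ofReal (a⁻¹ * t) < f x
    rw [ENNReal.ofReal_mul (inv_pos.2 ha).le, ENNReal.ofReal_inv_of_pos ha,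
      ← ENNReal.div_eq_inv_mul, ENNReal.div_lt_iff (.inl ha0) (.inl ENNReal.ofReal_ne_top), mul_comm]
  rw [h2]
  by_contra! htop
  rw [top_le_iff] at htop
  rw [htop, ENNReal.mul_top (by simpa using ha)] at h
  exact hf.ne h.symm

theorem choquetIntegral_max_le (f g : (Fin n → ℝ) → ℝ≥0∞) :
    choquetIntegral d (fun x => max (f x) (g x)) ≤ choquetIntegral d f + choquetIntegral d g := by
  rw [choquetIntegral, choquetIntegral, choquetIntegral,
    ← lintegral_add_left (antitone_dyadicContent_ofReal_lt f).measurable]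
  refine lintegral_mono fun t => (dyadicContent_mono fun x hx => ?_).trans
    (dyadicContent_union_le _ _)
  exact (lt_max_iff (a := ENNReal.ofReal t)).1 hx

/-- Only finiteness matters, so `f + g` is replaced by `2 max(f, g)`: superlevel sets of a maximum
are unions, for which subadditivity of the content is enough. -/
theorem choquetIntegral_rpow_lt_top_of_le_add {p : ℝ} (hp : 0 < p)
    {f g h : (Fin n → ℝ) → ℝ≥0∞} (hle : ∀ x, h x ≤ f x + g x)
    (hf : choquetIntegral d (fun x => f x ^ p) < ∞)
    (hg : choquetIntegral d (fun x => g x ^ p) < ∞) :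
    choquetIntegral d (fun x => h x ^ p) < ∞ := by
  have hfg := (choquetIntegral_max_le (d := d) (fun x => f x ^ p) fun x => g x ^ p).trans_lt
    (ENNReal.add_lt_top.2 ⟨hf, hg⟩)
  have h2 : (0 : ℝ) < 2 ^ p := by positivity
  refine (choquetIntegral_mono fun x => ?_).trans_lt (choquetIntegral_const_mul_lt_top h2 hfg)
  have hmono : Monotone fun y : ℝ≥0∞ => y ^ p := fun _ _ hab => ENNReal.rpow_le_rpow hab hp.le
  rw [← hmono.map_max, ← ENNReal.ofReal_rpow_of_pos two_pos, ENNReal.ofReal_ofNat,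
    ← ENNReal.mul_rpow_of_nonneg _ _ hp.le, two_mul]
  exact hmono ((hle x).trans (add_le_add (le_max_left _ _) (le_max_right _ _)))

theorem choquetIntegral_lt_top_of_bounded {f : (Fin n → ℝ) → ℝ≥0∞} {c : ℝ≥0∞} (hc : c ≠ ∞)
    (hfc : ∀ x, f x ≤ c) (hf : Bornology.IsBounded (Function.support f)) :
    choquetIntegral d f < ∞ := by
  have hm : MeasurableSet {t | ENNReal.ofReal t < c} :=
    measurableSet_lt ENNReal.measurable_ofReal measurable_const
  calc choquetIntegral d f ≤ ∫⁻ t in Set.Ioi (0 : ℝ),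
        {t | ENNReal.ofReal t < c}.indicator 1 t * dyadicContent d (Function.support f) := by
        refine lintegral_mono fun t => ?_
        by_cases ht : ENNReal.ofReal t < c
        · simp only [Set.mem_ofPred_eq, ht, Set.indicator_of_mem, Pi.one_apply, one_mul]
          exact dyadicContent_mono fun x hx => (zero_le.trans_lt hx).ne'
        · have : {x | ENNReal.ofReal t < f x} = ∅ := by
            ext x
            simpa using (hfc x).trans (not_lt.1 ht)
          simp [this, dyadicContent_empty]
    _ = c * dyadicContent d (Function.support f) := by
        rw [lintegral_mul_const _ (measurable_one.indicator hm), lintegral_indicator_ofReal_lt]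
    _ < ∞ := ENNReal.mul_lt_top hc.lt_top (dyadicContent_lt_top_of_isBounded hf)

theorem choquetIntegral_eq_choquetNorm_rpow {p : ℝ≥0∞} (hp0 : 0 < p.toReal) (hp : p ≠ ∞)
    (f : (Fin n → ℝ) → ℝ≥0∞) :
    choquetIntegral d (fun x => f x ^ p.toReal) = choquetNorm d p f ^ p.toReal := by
  rw [choquetNorm_of_ne_top hp, ← ENNReal.rpow_mul, one_div_mul_cancel hp0.ne', ENNReal.rpow_one]

theorem choquetIntegral_lt_top_of_mem_choquetSpace {p : ℝ≥0∞} (hp0 : 0 < p.toReal) (hp : p ≠ ∞)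
    {f : (Fin n → ℝ) → ℝ} (hf : f ∈ choquetSpace n d p) :
    choquetIntegral d (fun x => ‖f x‖ₑ ^ p.toReal) < ∞ := by
  obtain ⟨φ, hφ, hlim⟩ := hf
  obtain ⟨k, hk⟩ := (hlim.eventually (gt_mem_nhds one_pos)).exists
  refine choquetIntegral_rpow_lt_top_of_le_add hp0 (f := fun x => ‖f x - φ k x‖ₑ)
    (g := fun x => ‖φ k x‖ₑ) (fun x => ?_) ?_ ?_
  · simpa using enorm_add_le (f x - φ k x) (φ k x)
  · rw [choquetIntegral_eq_choquetNorm_rpow hp0 hp]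
    exact ENNReal.rpow_lt_top_of_nonneg hp0.le (hk.trans_le le_top).ne
  · obtain ⟨hcont, hcomp⟩ := hφ k
    obtain ⟨C, hC⟩ := hcont.bounded_above_of_compact_support hcomp
    refine choquetIntegral_lt_top_of_bounded (c := ENNReal.ofReal C ^ p.toReal)
      (ENNReal.rpow_ne_top_of_nonneg hp0.le ENNReal.ofReal_ne_top) (fun x => ?_)
      (hcomp.isBounded.subset fun x hx => ?_)
    · refine ENNReal.rpow_le_rpow ?_ hp0.le
      rw [← ofReal_norm]
      exact ENNReal.ofReal_le_ofReal (hC x)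
    · refine subset_tsupport _ fun h => hx ?_
      simp [h, hp0]

/-- Chebyshev turns norm convergence into convergence in content. Small content dominates volume, so
the continuous approximants converge in Lebesgue measure. -/
theorem aemeasurable_of_mem_choquetSpace (hd : 0 < d) (hdn : d ≤ n) {p : ℝ≥0∞}
    (hp0 : 0 < p.toReal) (hp : p ≠ ∞) {f : (Fin n → ℝ) → ℝ} (hf : f ∈ choquetSpace n d p) :
    AEMeasurable f volume := by
  obtain ⟨φ, hφ, hlim⟩ := hf
  refine TendstoInMeasure.aemeasurable (f := φ) (u := atTop)
    (fun k => (hφ k).1.measurable.aemeasurable) fun ε hε => ?_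
  -- A finite level strictly below `ε^p`: convergence in measure uses `≥ ε`, whereas Choquet
  -- superlevel sets are strict; `ε` may also be `∞`.
  obtain ⟨r, hr0, hr⟩ : ∃ r : ℝ, 0 < r ∧ ENNReal.ofReal r < ε ^ p.toReal := by
    obtain ⟨r, hr0, hr⟩ := ENNReal.lt_iff_exists_nnreal_btwn.1
      (ENNReal.rpow_pos_of_nonneg hε hp0.le)
    exact ⟨r, by simpa using hr0, by simpa using hr⟩
  have hr' : ENNReal.ofReal r ≠ 0 := by simpa using hr0
  have hH : Tendsto (fun k => dyadicContent d {x | ENNReal.ofReal r < ‖f x - φ k x‖ₑ ^ p.toReal})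
      atTop (𝓝 0) := by
    have h1 : Tendsto (fun k => choquetNorm d p (fun x => ‖f x - φ k x‖ₑ) ^ p.toReal /
        ENNReal.ofReal r) atTop (𝓝 0) := by
      have := ENNReal.Tendsto.div_const ((ENNReal.continuous_rpow_const (y := p.toReal)).tendsto 0
        |>.comp hlim) (.inr hr')
      simpa [hp0] using this
    refine tendsto_of_tendsto_of_tendsto_of_le_of_le tendsto_const_nhds h1
      (fun _ => zero_le) fun k => ?_
    show _ ≤ _
    rw [ENNReal.le_div_iff_mul_le (.inl hr') (.inl ENNReal.ofReal_ne_top), mul_comm,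
      ← choquetIntegral_eq_choquetNorm_rpow hp0 hp]
    exact ofReal_mul_dyadicContent_le_choquetIntegral _ r
  refine tendsto_of_tendsto_of_tendsto_of_le_of_le' tendsto_const_nhds hH
    (.of_forall fun _ => zero_le) ?_
  filter_upwards [hH.eventually (gt_mem_nhds one_pos)] with k hk
  refine (measure_mono fun x hx => ?_).trans (volume_le_dyadicContent_of_lt_one hd hdn hk)
  refine hr.trans_le (ENNReal.rpow_le_rpow ?_ hp0.le)
  rw [← edist_eq_enorm_sub, edist_comm]
  exact hx

/-- Either `a ≤ s` or `(a/s)^(p-1) ≥ 1`. The free parameter `s` makes this a substitute for Hölder's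
inequality. -/
theorem ENNReal.le_add_mul_rpow {p : ℝ} (hp : 1 ≤ p) {s : ℝ≥0∞} (hs0 : s ≠ 0) (hs : s ≠ ∞)
    (a : ℝ≥0∞) : a ≤ s + s ^ (1 - p) * a ^ p := by
  rcases le_total a s with h | h
  · exact le_add_right h
  · refine le_add_left ?_
    rcases eq_or_ne a ∞ with rfl | ha
    · rw [ENNReal.top_rpow_of_pos (by linarith), ENNReal.mul_top]
      simp [ENNReal.rpow_eq_zero_iff, hs0, hs]
    · have ha0 : a ≠ 0 := ne_bot_of_le_ne_bot hs0 h
      calc a = a ^ (1 - p) * a ^ p := by rw [← ENNReal.rpow_add _ _ ha0 ha]; simp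
        _ ≤ _ := by
          gcongr ?_ * _
          rw [← neg_sub p 1, ENNReal.rpow_neg, ENNReal.rpow_neg]
          exact ENNReal.inv_le_inv.2 (ENNReal.rpow_le_rpow h (by linarith))

theorem lintegral_lt_top_of_choquetIntegral_lt_top {μ : Measure (Fin n → ℝ)} [IsFiniteMeasure μ]
    {K : ℝ≥0∞} (hK : K ≠ ∞) (hμ : ∀ Q : DyadicCube n, μ Q.toSet ≤ K * Q.len ^ d) {p : ℝ}
    (hp : 1 ≤ p) {f : (Fin n → ℝ) → ℝ≥0∞} (hf : AEMeasurable f μ)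
    (hfin : choquetIntegral d (fun x => f x ^ p) < ∞) : ∫⁻ x, f x ∂μ < ∞ := by
  calc ∫⁻ x, f x ∂μ ≤ ∫⁻ x, (1 + f x ^ p) ∂μ :=
        lintegral_mono fun x => by
          simpa using ENNReal.le_add_mul_rpow hp one_ne_zero ENNReal.one_ne_top (f x)
    _ = μ Set.univ + ∫⁻ x, f x ^ p ∂μ := by
        rw [lintegral_add_left measurable_const, lintegral_one]
    _ ≤ μ Set.univ + K * choquetIntegral d (fun x => f x ^ p) := by
        gcongr
        exact lintegral_le_mul_choquetIntegral hK hμ (hf.pow_const p)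
    _ < ∞ := ENNReal.add_lt_top.2 ⟨measure_lt_top _ _, ENNReal.mul_lt_top hK.lt_top hfin⟩

theorem setLIntegral_lt_top_of_choquetIntegral_lt_top (hd : 0 ≤ d) (hdn : d ≤ n) {p : ℝ}
    (hp : 1 ≤ p) {f : (Fin n → ℝ) → ℝ≥0∞} (hf : AEMeasurable f volume)
    (hfin : choquetIntegral d (fun x => f x ^ p) < ∞) (Q : DyadicCube n) :
    ∫⁻ x in Q.toSet, f x < ∞ := by
  have : IsFiniteMeasure (volume.restrict Q.toSet) :=
    ⟨by simpa using Q.volume_toSet_ne_top.lt_top⟩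
  refine lintegral_lt_top_of_choquetIntegral_lt_top (Q.len_rpow_ne_top ((n : ℝ) - d))
    (fun R => ?_) hp hf.restrict hfin
  rw [Measure.restrict_apply R.measurableSet_toSet]
  exact DyadicCube.volume_inter_le hd hdn R Q

theorem setLAverage_le_of_choquetIntegral (hd : 0 ≤ d) (hdn : d ≤ n) {p : ℝ} (hp : 1 ≤ p)
    {f : (Fin n → ℝ) → ℝ≥0∞} (hf : AEMeasurable f volume) (Q : DyadicCube n) :
    ⨍⁻ x in Q.toSet, f x ∂volume ≤
      Q.len ^ (-(d / p)) * (1 + choquetIntegral d (fun x => f x ^ p)) := by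
  set N := choquetIntegral d (fun x => f x ^ p)
  -- This choice balances the two terms: `s^(1-p) ℓ(Q)^(n-d) = s |Q|`.
  set s := Q.len ^ (-(d / p)) with hs
  have hp0 : p ≠ 0 := by linarith
  have hs0 : s ≠ 0 := Q.len_rpow_ne_zero _
  have hst : s ≠ ∞ := Q.len_rpow_ne_top _
  have hpow : ∫⁻ x in Q.toSet, f x ^ p ≤ Q.len ^ ((n : ℝ) - d) * N :=
    lintegral_le_mul_choquetIntegral (Q.len_rpow_ne_top _) (fun R => by
      rw [Measure.restrict_apply R.measurableSet_toSet]
      exact DyadicCube.volume_inter_le hd hdn R Q) (hf.pow_const p).restrict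
  rw [setLAverage_eq]
  refine ENNReal.div_le_of_le_mul ?_
  calc ∫⁻ x in Q.toSet, f x ≤ ∫⁻ x in Q.toSet, (s + s ^ (1 - p) * f x ^ p) :=
        lintegral_mono fun x => ENNReal.le_add_mul_rpow hp hs0 hst (f x)
    _ = s * volume Q.toSet + s ^ (1 - p) * ∫⁻ x in Q.toSet, f x ^ p := by
        rw [lintegral_add_left measurable_const, setLIntegral_const, lintegral_const_mul' _ _
          (by simp [hs0, hst])]
    _ ≤ s * volume Q.toSet + s ^ (1 - p) * (Q.len ^ ((n : ℝ) - d) * N) := by gcongr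
    _ = s * volume Q.toSet + s * volume Q.toSet * N := by
        congr 1
        rw [← mul_assoc, Q.volume_toSet, hs, ← ENNReal.rpow_mul,
          ← ENNReal.rpow_add _ _ Q.len_ne_zero Q.len_ne_top,
          ← ENNReal.rpow_add _ _ Q.len_ne_zero Q.len_ne_top]
        congr 2
        field_simp
        ring
    _ = _ := by ring

end ChoquetSpace

/-! ### Almost everywhere finiteness of the sparse operator -/

section Finiteness

variable {n : ℕ} {S : Set (DyadicCube n)} {d η : ℝ}

theorem IsSparseFamily.mono {T : Set (DyadicCube n)} (hT : IsSparseFamily η T) (h : S ⊆ T) :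
    IsSparseFamily η S := by
  obtain ⟨E, hE, hdisj⟩ := hT
  exact ⟨E, fun Q hQ => hE Q (h hQ), hdisj.subset h⟩

theorem IsSparseFamily.tsum_volume_le (hS : IsSparseFamily η S) (hη : 0 < η)
    {F : Set (DyadicCube n)} (hF : F ⊆ S) {B : Set (Fin n → ℝ)} (hB : ∀ Q ∈ F, Q.toSet ⊆ B) :
    ∑' Q : F, volume (Q : DyadicCube n).toSet ≤ (ENNReal.ofReal η)⁻¹ * volume B := by
  obtain ⟨E, hE, hdisj⟩ := hS
  have hη0 : ENNReal.ofReal η ≠ 0 := by simpa using hη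
  calc ∑' Q : F, volume (Q : DyadicCube n).toSet
      ≤ ∑' Q : F, (ENNReal.ofReal η)⁻¹ * volume (E Q) := by
        refine ENNReal.tsum_le_tsum fun Q => ?_
        rw [← ENNReal.div_eq_inv_mul, ENNReal.le_div_iff_mul_le (.inl hη0)
          (.inl ENNReal.ofReal_ne_top), mul_comm]
        exact (hE Q (hF Q.2)).2.2
    _ = (ENNReal.ofReal η)⁻¹ * ∑' Q : F, volume (E Q) := ENNReal.tsum_mul_left
    _ ≤ (ENNReal.ofReal η)⁻¹ * volume (⋃ Q ∈ F, Q.toSet) := by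
        gcongr
        exact tsum_measure_le_of_pairwiseDisjoint
          (fun Q hQ => ⟨(hE Q (hF hQ)).1, (hE Q (hF hQ)).2.1⟩) (hdisj.subset hF)
    _ ≤ _ := by
        gcongr
        exact Set.iUnion₂_subset hB

/-- The part of the sparse operator living on subcubes of `P` is integrable on `P`. -/
theorem IsSparseFamily.setLIntegral_sparseOperatorENN_lt_top (hS : IsSparseFamily η S)
    (hη : 0 < η) (hd : 0 ≤ d) (hdn : d < n) {P : DyadicCube n} (hSP : ∀ Q ∈ S, Q.Sub P) {p : ℝ}
    (hp : 1 ≤ p) {f : (Fin n → ℝ) → ℝ≥0∞} (hf : AEMeasurable f volume)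
    (hfin : choquetIntegral d (fun x => f x ^ p) < ∞) :
    ∫⁻ x in P.toSet, sparseOperatorENN S f x < ∞ := by
  -- Duality with `1_P`: the measure with density `A_S 1_P` has plain `d`-dimensional growth, the
  -- general growth lemma being applied with the constant weight `ℓ(P)^(n-d)`.
  let v : (Fin n → ℝ) → ℝ≥0∞ := P.toSet.indicator 1
  have hv : Measurable v := measurable_one.indicator P.measurableSet_toSet
  have hη0 : ENNReal.ofReal η ≠ 0 := by simpa using hη
  have hvQ (Q : DyadicCube n) : ∫⁻ y in Q.toSet, v y = volume (Q.toSet ∩ P.toSet) := by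
    rw [lintegral_indicator_one P.measurableSet_toSet,
      Measure.restrict_apply P.measurableSet_toSet, Set.inter_comm]
  have hvol (Q : DyadicCube n) : volume Q.toSet * (volume (Q.toSet ∩ P.toSet) / volume Q.toSet) =
      volume (Q.toSet ∩ P.toSet) :=
    ENNReal.mul_div_cancel Q.volume_toSet_ne_zero Q.volume_toSet_ne_top
  let μ : Measure (Fin n → ℝ) := volume.withDensity (sparseOperatorENN S v)
  let K : ℝ≥0∞ := ((ENNReal.ofReal η)⁻¹ + (1 - (2 : ℝ≥0∞) ^ (-((n : ℝ) - d)))⁻¹)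
  have hK : K ≠ ∞ := ENNReal.add_ne_top.2
    ⟨by simp [hη0], DyadicCube.inv_one_sub_two_rpow_ne_top (sub_pos.2 hdn)⟩
  have hμ (R : DyadicCube n) : μ R.toSet ≤ K * P.len ^ ((n : ℝ) - d) * R.len ^ d := by
    rw [withDensity_apply _ R.measurableSet_toSet, mul_right_comm]
    refine setLIntegral_sparseOperatorENN_le (W := fun _ => P.len ^ ((n : ℝ) - d))
      (a := fun Q => volume (Q.toSet ∩ P.toSet) / volume Q.toSet) (fun R => ?_)
      (fun Q => by rw [hvol, hvQ]) (fun Q x _ => ?_) R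
      -- The weight is constant, so any point of `R` will do; the lower corner belongs to the
      -- half-open cube.
      (x := fun i => R.side * R.corner i) (fun i => ⟨le_rfl, ?_⟩)
    · rw [mul_assoc, hvol]
      calc _ ≤ ∑' Q : {Q | Q ∈ S ∧ Q.Sub R}, volume (Q : DyadicCube n).toSet :=
            ENNReal.tsum_le_tsum fun Q => by
              rw [hvQ]
              exact measure_mono Set.inter_subset_left
        _ ≤ _ := hS.tsum_volume_le hη (fun Q hQ => hQ.1)
            fun Q hQ => Set.subset_inter hQ.2.2 (hSP Q hQ.1).2
    · rw [← mul_div_assoc]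
      refine ENNReal.div_le_of_le_mul ?_
      calc _ ≤ Q.len ^ ((n : ℝ) - d) * (P.len ^ ((n : ℝ) - d) * Q.len ^ d) := by
            gcongr
            exact DyadicCube.volume_inter_le hd hdn.le Q P
        _ = _ := by
            rw [mul_left_comm, ← ENNReal.rpow_add _ _ Q.len_ne_zero Q.len_ne_top, sub_add_cancel,
              Q.volume_toSet]
    · exact mul_lt_mul_of_pos_left (lt_add_one _) R.side_pos
  have : IsFiniteMeasure μ := by
    refine ⟨?_⟩
    rw [withDensity_apply _ .univ, setLIntegral_univ]
    calc ∫⁻ x, sparseOperatorENN S v x = ∫⁻ x, sparseOperatorENN S v x * 1 := by simp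
      _ = ∑' Q : S, ∫⁻ y in (Q : DyadicCube n).toSet, v y := by
          rw [lintegral_sparseOperatorENN_mul v aemeasurable_const]
          refine tsum_congr fun Q => ?_
          rw [setLIntegral_one, setLAverage_mul_volume]
      _ ≤ ∑' Q : S, volume (Q : DyadicCube n).toSet :=
          ENNReal.tsum_le_tsum fun Q => by
            rw [hvQ]
            exact measure_mono Set.inter_subset_left
      _ ≤ (ENNReal.ofReal η)⁻¹ * volume P.toSet :=
          hS.tsum_volume_le hη le_rfl fun Q hQ => (hSP Q hQ).2
      _ < ∞ := ENNReal.mul_lt_top (by simp [hη]) P.volume_toSet_ne_top.lt_top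
  calc ∫⁻ x in P.toSet, sparseOperatorENN S f x = ∫⁻ x, sparseOperatorENN S f x * v x := by
        rw [← lintegral_indicator P.measurableSet_toSet]
        refine lintegral_congr fun x => ?_
        by_cases hx : x ∈ P.toSet <;> simp [v, hx]
    _ = ∫⁻ x, sparseOperatorENN S v x * f x :=
        lintegral_sparseOperatorENN_mul_comm hf hv.aemeasurable
    _ = ∫⁻ x, f x ∂μ := (lintegral_withDensity_eq_lintegral_mul₀
        (measurable_sparseOperatorENN S v).aemeasurable hf).symm
    _ < ∞ := lintegral_lt_top_of_choquetIntegral_lt_top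
        (ENNReal.mul_ne_top hK (P.len_rpow_ne_top _)) hμ hp
        (hf.mono_ac (withDensity_absolutelyContinuous _ _)) hfin

/-- Split `S` at the unit cube `P ∋ x`. Subcubes of `P` give an integrable function on `P`; on
larger cubes the averages decay like `ℓ(Q)^(-d/p)`, summable as `d > 0`. -/
theorem IsSparseFamily.ae_sparseOperatorENN_lt_top (hS : IsSparseFamily η S) (hη : 0 < η)
    (hd : 0 < d) (hdn : d < n) {p : ℝ} (hp : 1 ≤ p) {f : (Fin n → ℝ) → ℝ≥0∞}
    (hf : AEMeasurable f volume) (hfin : choquetIntegral d (fun x => f x ^ p) < ∞) :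
    ∀ᵐ x, sparseOperatorENN S f x < ∞ := by
  have hlocal : ∀ P : DyadicCube n, ∀ᵐ x, x ∈ P.toSet →
      sparseOperatorENN {Q | Q ∈ S ∧ Q.Sub P} f x < ∞ := fun P => by
    rw [← ae_restrict_iff' P.measurableSet_toSet]
    exact ae_lt_top (measurable_sparseOperatorENN _ f)
      ((hS.mono fun Q hQ => hQ.1).setLIntegral_sparseOperatorENN_lt_top hη hd.le hdn
        (fun Q hQ => hQ.2) hp hf hfin).ne
  filter_upwards [ae_all_iff.2 hlocal] with x hx
  set P := DyadicCube.containing 0 x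
  have hxP : x ∈ P.toSet := DyadicCube.mem_containing 0 x
  let A : Set (DyadicCube n) := {Q | Q ∈ S ∧ Q.Sub P}
  let B : Set (DyadicCube n) := {Q | Q.scale < P.scale ∧ x ∈ Q.toSet}
  let m : DyadicCube n → ℝ≥0∞ := fun Q => ⨍⁻ y in Q.toSet, f y ∂volume
  let ψ : DyadicCube n → ℝ≥0∞ := fun Q => Q.toSet.indicator (fun _ => m Q) x
  have hpt (Q : DyadicCube n) : S.indicator ψ Q ≤ A.indicator ψ Q + B.indicator m Q := by
    by_cases hQ : Q ∈ S
    swap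
    · simp [hQ]
    rw [Set.indicator_of_mem hQ]
    rcases Q.sub_or_lt_or_disjoint P with h | ⟨h, hsub⟩ | h
    · rw [Set.indicator_of_mem (show Q ∈ A from ⟨hQ, h⟩)]
      exact le_self_add
    · rw [Set.indicator_of_mem (show Q ∈ B from ⟨h, hsub hxP⟩)]
      exact le_add_left (Set.indicator_le_self' (by simp) x)
    · simp [ψ, Set.disjoint_right.1 h hxP]
  have hdp : 0 < d / p := div_pos hd (by linarith)
  calc sparseOperatorENN S f x = ∑' Q, S.indicator ψ Q := tsum_subtype S ψ
    _ ≤ ∑' Q, (A.indicator ψ Q + B.indicator m Q) := ENNReal.tsum_le_tsum hpt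
    _ = ∑' Q : A, ψ Q + ∑' Q : B, m Q := by rw [ENNReal.tsum_add, tsum_subtype, tsum_subtype]
    _ ≤ sparseOperatorENN A f x + ∑' Q : B, (Q : DyadicCube n).len ^ (-(d / p)) *
          (1 + choquetIntegral d (fun x => f x ^ p)) := by
        refine add_le_add le_rfl (ENNReal.tsum_le_tsum fun Q => ?_)
        exact setLAverage_le_of_choquetIntegral hd.le hdn.le hp hf Q
    _ < ∞ := by
        rw [ENNReal.tsum_mul_right]
        refine ENNReal.add_lt_top.2 ⟨hx P hxP, ENNReal.mul_lt_top
          ((P.tsum_ancestors_len_rpow_le x).trans_lt ?_) (by simpa using hfin)⟩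
        exact ENNReal.mul_lt_top (DyadicCube.inv_one_sub_two_rpow_ne_top hdp).lt_top
          (P.len_rpow_ne_top _).lt_top

end Finiteness

/-! ### Passage to real-valued functions and the theorem -/

section RealValued

variable {n : ℕ} {S : Set (DyadicCube n)}

theorem enorm_indicator_setAverage_le (f : (Fin n → ℝ) → ℝ) (Q : DyadicCube n) (x : Fin n → ℝ) :
    ‖Q.toSet.indicator (fun _ => ⨍ y in Q.toSet, f y) x‖ₑ ≤
      Q.toSet.indicator (fun _ => ⨍⁻ y in Q.toSet, ‖f y‖ₑ ∂volume) x := by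
  by_cases hx : x ∈ Q.toSet
  · simp only [hx, Set.indicator_of_mem]
    exact enorm_integral_le_lintegral_enorm _
  · simp [hx]

theorem enorm_sparseOperator_le (f : (Fin n → ℝ) → ℝ) (x : Fin n → ℝ) :
    ‖sparseOperator S f x‖ₑ ≤ sparseOperatorENN S (fun y => ‖f y‖ₑ) x :=
  enorm_tsum_le_tsum_enorm.trans
    (ENNReal.tsum_le_tsum fun Q => enorm_indicator_setAverage_le f Q x)

theorem summable_sparseOperator {f : (Fin n → ℝ) → ℝ} {x : Fin n → ℝ}
    (h : sparseOperatorENN S (fun y => ‖f y‖ₑ) x < ∞) :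
    Summable fun Q : S => (Q : DyadicCube n).toSet.indicator
      (fun _ => ⨍ y in (Q : DyadicCube n).toSet, f y) x := by
  refine .of_nnnorm (ENNReal.tsum_coe_ne_top_iff_summable.1 ?_)
  exact ((ENNReal.tsum_le_tsum fun Q : S =>
    enorm_indicator_setAverage_le f Q x).trans_lt h).ne

theorem aemeasurable_sparseOperator {f : (Fin n → ℝ) → ℝ}
    (h : ∀ᵐ x, sparseOperatorENN S (fun y => ‖f y‖ₑ) x < ∞) :
    AEMeasurable (sparseOperator S f) volume := by
  refine aemeasurable_of_tendsto_metrizable_ae (atTop : Filter (Finset S))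
    (f := fun (F : Finset S) x => ∑ Q ∈ F, (Q : DyadicCube n).toSet.indicator
      (fun _ => ⨍ y in (Q : DyadicCube n).toSet, f y) x)
    (fun F => (Finset.measurable_fun_sum F fun Q _ => measurable_const.indicator
      (Q : DyadicCube n).measurableSet_toSet).aemeasurable) ?_
  filter_upwards [h] with x hx
  simpa [HasSum, sparseOperator] using (summable_sparseOperator hx).hasSum

theorem associateNorm_mono {N : ((Fin n → ℝ) → ℝ) → ℝ≥0∞} {f g : (Fin n → ℝ) → ℝ≥0∞}
    (h : ∀ x, f x ≤ g x) : associateNorm N f ≤ associateNorm N g := by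
  unfold associateNorm
  gcongr with g' _ _ x
  exact h x

end RealValued

theorem theorem2p1 (n : ℕ) (d : ℝ) (hd : 0 < d) (hdn : d < n)
    (p p' : ℝ≥0∞) (hp : 1 ≤ p) (hp_top : p ≠ ∞) (hpp' : ENNReal.HolderConjugate p p')
    (η : ℝ) (hη : 0 < η) (hη1 : η < 1) :
    ∃ C : ℝ≥0, ∀ S : Set (DyadicCube n), IsSparseFamily η S →
      -- nonnegative functions
      (∀ f : (Fin n → ℝ) → ℝ≥0∞, AEMeasurable f volume →
        associateNorm (orliczMorreyNorm d p' Phi0) (sparseOperatorENN S f)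
          ≤ C * choquetNorm d p f) ∧
      -- the Choquet space
      (∀ f ∈ choquetSpace n d p,
        (∀ Q ∈ S, IntegrableOn f Q.toSet volume) ∧
        (∀ᵐ x, Summable fun Q : S => (Q : DyadicCube n).toSet.indicator
          (fun _ => ⨍ y in (Q : DyadicCube n).toSet, f y) x) ∧
        sparseOperator S f ∈ associateSpace (orliczMorreyNorm (n := n) d p' Phi0) ∧
        associateNorm (orliczMorreyNorm d p' Phi0) (fun x => ‖sparseOperator S f x‖ₑ)
          ≤ C * choquetNorm d p (fun x => ‖f x‖ₑ)) := by
  have hC : 4 * sparseConst n d η ≠ ∞ := ENNReal.mul_ne_top (by simp) (sparseConst_ne_top hdn hη)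
  refine ⟨(4 * sparseConst n d η).toNNReal, fun S hS => ?_⟩
  rw [ENNReal.coe_toNNReal hC]
  refine ⟨fun f hf => hS.associateNorm_sparseOperatorENN_le hη hd hdn hp_top hpp' hf,
    fun f hf => ?_⟩
  have hp1 : 1 ≤ p.toReal := by simpa using ENNReal.toReal_mono hp_top hp
  have hp0 : 0 < p.toReal := by linarith
  have hfm := aemeasurable_of_mem_choquetSpace hd hdn.le hp0 hp_top hf
  have hfin := choquetIntegral_lt_top_of_mem_choquetSpace hp0 hp_top hf
  have hae := hS.ae_sparseOperatorENN_lt_top hη hd hdn hp1 hfm.enorm hfin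
  -- The pointwise domination holds even where the series diverges, since `tsum` is then `0`.
  have hbound : associateNorm (orliczMorreyNorm d p' Phi0) (fun x => ‖sparseOperator S f x‖ₑ) ≤
      4 * sparseConst n d η * choquetNorm d p (fun x => ‖f x‖ₑ) :=
    (associateNorm_mono (enorm_sparseOperator_le f)).trans
      (hS.associateNorm_sparseOperatorENN_le hη hd hdn hp_top hpp' hfm.enorm)
  refine ⟨fun Q _ => ⟨hfm.aestronglyMeasurable.restrict, ?_⟩, ?_,
    ⟨aemeasurable_sparseOperator hae, hbound.trans_lt (ENNReal.mul_lt_top hC.lt_top ?_)⟩, hbound⟩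
  · exact setLIntegral_lt_top_of_choquetIntegral_lt_top hd.le hdn.le hp1 hfm.enorm hfin Q
  · filter_upwards [hae] with x hx using summable_sparseOperator hx
  · rw [choquetNorm_of_ne_top hp_top]
    exact ENNReal.rpow_lt_top_of_nonneg (by positivity) hfin.ne
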